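/- Conventions. Let $\Gamma$ be a group generated by a finite set $S$, let $G$ be its Cayley graph (vertex set $\Gamma$, an edge between $g$ and $gs$ for $g\in\Gamma$, $s\in S$), and let $d$ be the path metric; put $(b|c)_a=\frac12[d(a,b)+d(a,c)-d(b,c)]$. For $\delta\ge 0$, geodesic triangles of $G$ are called $\delta$-fine if for all vertices $a,b,c$, all geodesic edge paths $[a,b]$, $[a,c]$, and all vertices $v\in[a,b]$, $w\in[a,c]$ with $d(a,v)=d(a,w)\le (b|c)_a$, one has $d(v,w)\le\delta$. The group $\Gamma$ is hyperbolic if for some finite generating set $S$ and some $\delta\ge0$ geodesic triangles are $\delta$-fine. Spaces $l^p$ and $L^p$ are real. An affine isometric action $\alpha$ of $\Gamma$ on a Banach space $E$ is a homomorphism from $\Gamma$ to the group of bijective affine isometries of $E$; it is proper if $\lim_{g\to\infty}\|\alpha(g)\xi\|=\infty$ for every $\xi\in E$. Fix a finite generating set $S$, an integer $\delta\ge1$ such that geodesic triangles are $\delta$-fine, and an equivariant geodesic bicombing $q$, i.e. geodesic edge paths $q[a,b]$ from $a$ to $b$ for all $a,b\in\Gamma$ with $q[ga,gb]=g\,q[a,b]$;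 $q[a,b](t)$ is the vertex of $q[a,b]$ at distance $t$ from $a$. Put $Fl(a,b)=\{x\in\Gamma: d(a,x)=d(a,b),\ d(b,x)\le\delta\}$, $pr_a(a)=a$, and, for $b\ne a$, $pr_a(b)=q[a,b](t)$ with $t$ the largest integral multiple of $10\delta$ strictly less than $d(a,b)$. Mineyev's $0$-chains $f(a,b)$ (finitely supported functions $\Gamma\to\mathbb Q$) are defined by recursion on $d(a,b)$: $f(a,b)=b$ if $d(a,b)\le10\delta$; $f(a,b)=f(a,pr_a(b))$ if $d(a,b)>10\delta$ is not a multiple of $10\delta$; $f(a,b)=\frac1{\#Fl(a,b)}\sum_{x\in Fl(a,b)}f(a,pr_a(x))$ if $d(a,b)>10\delta$ is a multiple of $10\delta$. For $p\ge 2$ put $h(b,a)=f(b,a)/\|f(b,a)\|_p$ and define $\eta:\Gamma\times\Gamma\to\mathbb R$ by $\eta(\gamma,x)=h(\gamma,e)(x)$, where $e$ is the identity and $\|\cdot\|_p$ is the $l^p$-norm. For a function $\xi$ on $\Gamma\times\Gamma$ put $(\pi(g)\xi)(\gamma,x)=\xi(g^{-1}\gamma,g^{-1}x)$. Theorem 1.1.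 Let $\Gamma$ be a hyperbolic group. (1) There is $2\le p<\infty$ such that $\Gamma$ admits a proper affine isometric action on $l^p(\Gamma\times\Gamma)$. (2) More precisely, for every choice of $S$, $\delta$, $q$ as above there is $2\le p<\infty$ such that $\pi(g)\eta-\eta\in l^p(\Gamma\times\Gamma)$ for all $g\in\Gamma$, and $$\alpha(g)\xi=\pi(g)\xi+\pi(g)\eta-\eta$$ defines a proper affine isometric action of $\Gamma$ on $l^p(\Gamma\times\Gamma)$. (3) Consequently, if $\Gamma$ is infinite and has Kazhdan's Property (T), then for some $2<p<\infty$ there are a $\sigma$-finite measure space $(X,\mu)$ and an affine isometric action of $\Gamma$ on $L^p(X,\mu)$ without a fixed point. That is, such a $\Gamma$ answers negatively the question of Bader and Gelander whether every affine isometric action of a Property (T) group on an $L^p$-space has a fixed point. -/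

import Mathlib

open scoped ENNReal

universe u

noncomputable section

namespace YuHyperbolic

/-! ### Word metrics, Gromov products, hyperbolic groups -/

section WordMetric

variable {Γ : Type u} [Group Γ]

/-- The word metric `d` of `S`: the path metric of the Cayley graph of `S` (with an edge between `g`
and `g * s` for `s ∈ S`), restricted to the vertices. (If `S` generates, the graph is connected, so
that `SimpleGraph.dist` is the minimal length of an edge path.) -/
def wordDist (S : Set Γ) (a b : Γ) : ℕ := (SimpleGraph.mulCayley S).dist a b

/-- An edge path from `a` to `b` is geodesic if it is a shortest one. -/
def IsGeodesic {S : Set Γ} {a b : Γ} (w : (SimpleGraph.mulCayley S).Walk a b) : Prop :=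
  w.length = wordDist S a b

/-- The Gromov product `(b|c)_a = (d(a,b) + d(a,c) - d(b,c)) / 2`. -/
def gromovProduct (S : Set Γ) (a b c : Γ) : ℝ :=
  ((wordDist S a b : ℝ) + (wordDist S a c : ℝ) - (wordDist S b c : ℝ)) / 2

/-- Geodesic triangles are `δ`-fine: on two geodesics `[a,b]`, `[a,c]` with a common origin `a`, the
vertices `v ∈ [a,b]` and `w ∈ [a,c]` with `d(a,v) = d(a,w) = t ≤ (b|c)_a` satisfy `d(v,w) ≤ δ`.
Only vertices `v`, `w` of the graph are tested. If points inside edges are tested as well,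
the condition for `δ` becomes formally stronger, but it is then implied by the one below with `δ`
replaced by `δ - 2`, because such points are at distance at most `1` from the vertices at distance
`⌊t⌋` from `a`. -/
def TrianglesFine (S : Set Γ) (δ : ℝ) : Prop :=
  ∀ (a b c : Γ) (α : (SimpleGraph.mulCayley S).Walk a b) (β : (SimpleGraph.mulCayley S).Walk a c),
    IsGeodesic α → IsGeodesic β →
    ∀ t : ℕ, (t : ℝ) ≤ gromovProduct S a b c →
      (wordDist S (α.getVert t) (β.getVert t) : ℝ) ≤ δ

/-- A group is hyperbolic if it has a finite generating set for which all geodesic triangles of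
the Cayley graph are `δ`-fine, for some `δ ≥ 0`. -/
def IsHyperbolicGroup (Γ : Type u) [Group Γ] : Prop :=
  ∃ S : Set Γ, S.Finite ∧ Subgroup.closure S = ⊤ ∧ ∃ δ : ℝ, 0 ≤ δ ∧ TrianglesFine S δ

/-- A `Γ`-equivariant geodesic bicombing of the Cayley graph of `S`. The equation
`q[g a, g b] = g q[a,b]` of paths is expressed vertex by vertex. -/
structure EquivariantGeodesicBicombing (S : Set Γ) where
  /-- the edge path `q[a,b]` from `a` to `b` -/
  path : ∀ a b : Γ, (SimpleGraph.mulCayley S).Walk a b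
  geodesic : ∀ a b : Γ, IsGeodesic (path a b)
  equivariant : ∀ (g a b : Γ) (t : ℕ),
    (path (g * a) (g * b)).getVert t = g * (path a b).getVert t

end WordMetric

/-! ### Mineyev's 0-chains -/

section Mineyev

variable {Γ : Type u} [Group Γ] {S : Set Γ}

/-- The flower `Fl(v,w) = S(v, d(v,w)) ∩ B(w, δ)`. -/
def flower (S : Set Γ) (δ : ℕ) (v w : Γ) : Set Γ :=
  {x | wordDist S v x = wordDist S v w ∧ wordDist S w x ≤ δ}

open Classical in
/-- The map `pr_a`: `pr_a(a) = a`, and for `b ≠ a`, `pr_a(b) = q[a,b](t)`, where `t` is the largest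
integral multiple of `10δ` strictly less than `d(a,b)`. -/
def proj (q : EquivariantGeodesicBicombing S) (δ : ℕ) (a b : Γ) : Γ :=
  if b = a then a
  else (q.path a b).getVert (10 * δ * ((wordDist S a b - 1) / (10 * δ)))

/-- The map `pr_a` moves points closer to `a`. -/
theorem wordDist_proj_lt (q : EquivariantGeodesicBicombing S) (δ : ℕ) (a b : Γ)
    (h : 0 < wordDist S a b) : wordDist S a (proj q δ a b) < wordDist S a b := by
  unfold proj
  split_ifs with hba
  · subst hba
    simp [wordDist] at h
  · have h1 : wordDist S a ((q.path a b).getVert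
        (10 * δ * ((wordDist S a b - 1) / (10 * δ)))) ≤
        10 * δ * ((wordDist S a b - 1) / (10 * δ)) := by
      refine (SimpleGraph.dist_le ((q.path a b).take _)).trans ?_
      rw [SimpleGraph.Walk.take_length]
      exact min_le_left _ _
    have h2 := Nat.mul_div_le (wordDist S a b - 1) (10 * δ)
    omega

open Classical in
/-- Mineyev's 0-chain `f(a,b)` with rational coefficients, by recursion on `d(a,b)`:
* `f(a,b) = b` if `d(a,b) ≤ 10δ`;
* `f(a,b) = f(a, pr_a(b))` if `d(a,b) > 10δ` is not an integral multiple of `10δ`;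
* `f(a,b) = (# Fl(a,b))⁻¹ ∑_{x ∈ Fl(a,b)} f(a, pr_a(x))` if `d(a,b) > 10δ` is a multiple of `10δ`.

(Flowers are finite sets, because `S` is finite.) -/
def mineyevChain (q : EquivariantGeodesicBicombing S) (δ : ℕ) (a b : Γ) : Γ →₀ ℚ :=
  if wordDist S a b ≤ 10 * δ then Finsupp.single b 1
  else if ¬ (10 * δ ∣ wordDist S a b) then mineyevChain q δ a (proj q δ a b)
  else (Nat.card (flower S δ a b) : ℚ)⁻¹ •
    ∑ᶠ x : flower S δ a b, mineyevChain q δ a (proj q δ a x.1)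
termination_by wordDist S a b
decreasing_by
  · exact wordDist_proj_lt q δ a b (by omega)
  · have hx : wordDist S a x.1 = wordDist S a b := x.2.1
    rw [← hx]
    exact wordDist_proj_lt q δ a x.1 (by omega)

/-- The `l^p`-norm of a 0-chain (a finite sum). -/
def chainLpNorm (p : ℝ) (c : Γ →₀ ℚ) : ℝ :=
  (c.sum fun _ r => |(r : ℝ)| ^ p) ^ (1 / p)

/-- The normalized chain `h(b,a) = f(b,a) / ‖f(b,a)‖_p`, as a function on `Γ`. -/
def normalizedChain (q : EquivariantGeodesicBicombing S) (δ : ℕ) (p : ℝ) (b a x : Γ) : ℝ :=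
  (mineyevChain q δ b a x : ℝ) / chainLpNorm p (mineyevChain q δ b a)

/-- The function `η` on `Γ × Γ`, `η(γ, x) = h(γ, e)(x)`. -/
def eta (q : EquivariantGeodesicBicombing S) (δ : ℕ) (p : ℝ) (z : Γ × Γ) : ℝ :=
  normalizedChain q δ p z.1 1 z.2

end Mineyev

/-! ### Affine isometric actions, property (T) -/

/-- The real Banach space `l^p(Γ × Γ)`. -/
abbrev LpSquare (Γ : Type u) (p : ℝ≥0∞) : Type u := lp (fun _ : Γ × Γ => ℝ) p

/-- An affine isometric action of a (discrete) group on a real normed space is proper if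
`‖α(g) ξ‖ → ∞` as `g → ∞` in the group, for every vector `ξ`. -/
def IsProperAction {Γ : Type*} [Group Γ] {E : Type*} [NormedAddCommGroup E] [NormedSpace ℝ E]
    (α : Γ →* (E ≃ᵃⁱ[ℝ] E)) : Prop :=
  ∀ ξ : E, Filter.Tendsto (fun g : Γ => ‖α g ξ‖) Filter.cofinite Filter.atTop

/-- Kazhdan's Property (T) for a discrete group: there are a finite set `K` and an `ε > 0` such that
every unitary representation with a `(K, ε)`-invariant vector has a nonzero invariant vector. -/
def HasPropertyT (Γ : Type u) [Group Γ] : Prop :=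
  ∃ (K : Finset Γ) (ε : ℝ), 0 < ε ∧
    ∀ (H : Type u) [NormedAddCommGroup H] [InnerProductSpace ℂ H] [CompleteSpace H]
      (π : Γ →* (H ≃ₗᵢ[ℂ] H)),
      (∃ v : H, v ≠ 0 ∧ ∀ g ∈ K, ‖π g v - v‖ < ε * ‖v‖) →
        ∃ v : H, v ≠ 0 ∧ ∀ g : Γ, π g v = v

end YuHyperbolic

end

/-! The chain f(a,b) is a probability chain near a that points towards b: if d(a,b) ≥ 10δ, it lives
on the sphere of radius 10δ about a, and passing through its support lengthens the way from a to b
by at most 2δ. By equivariance (π(g)η)(γ,x) = h(γ,g)(x), so π(g)η - η compares, at each γ, the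
direction of g with the direction of e.

Integrability. Move b to a neighbour. Each level 10δk crossed on the way down to a replaces a point
by an average over its flower. Flowers of nearby points on one level share a point, and fineness
brings all the projections back within δ, so each level contracts the pointwise difference by λ = 1
- 1/N², where N bounds the size of a flower (`abs_average_sub_average_le`,
`abs_mineyevChain_sub_le`). Normalization costs only a constant, since the supports have bounded
size. Balls grow at most exponentially, so for large p the factor λ^p per level beats the growth and
π(s)η - η is in l^p for each generator s (`exists_memlp_eta_sub`); the cocycle identity extends this
to Γ.

Properness. If γ lies on a geodesic from e to g, at distance at least 10δ from both ends, then
f(γ,e) and f(γ,g) point in opposite directions and have disjoint supports. Such a γ contributes at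
least ‖h(γ,e)‖_p^p = 1 to ‖π(g)η - η‖^p, which therefore grows at least linearly in d(e,g)
(`card_le_norm_rpow`).

A proper action of an infinite group fixes no point, and l^p of a countable set is the L^p-space of
counting measure; this gives the last assertion. -/

namespace YuHyperbolic

/-! ### Word metric, geodesics and growth -/

section Metric

variable {Γ : Type u} [Group Γ] {S : Set Γ}

theorem wordDist_self (a : Γ) : wordDist S a a = 0 := by simp [wordDist]

theorem wordDist_comm (a b : Γ) : wordDist S a b = wordDist S b a := SimpleGraph.dist_comm

theorem reachable_mul_of_mem_closure {g : Γ} (hg : g ∈ Subgroup.closure S) :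
    ∀ a : Γ, (SimpleGraph.mulCayley S).Reachable a (a * g) := by
  induction hg using Subgroup.closure_induction with
  | mem s hs =>
    intro a
    by_cases h : a = a * s
    · rw [← h]
    · exact SimpleGraph.Adj.reachable ((SimpleGraph.mulCayley_adj S _ _).2 ⟨h, by simp [hs]⟩)
  | one => intro a; simp
  | mul x y _ _ hx hy => intro a; rw [← mul_assoc]; exact (hx a).trans (hy (a * x))
  | inv x _ hx => intro a; simpa using (hx (a * x⁻¹)).symm

theorem mulCayley_connected (hS : Subgroup.closure S = ⊤) : (SimpleGraph.mulCayley S).Connected where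
  preconnected a b := by
    have h := reachable_mul_of_mem_closure (S := S) (g := a⁻¹ * b) (by simp [hS]) a
    simpa using h
  nonempty := ⟨1⟩

theorem wordDist_triangle (hS : Subgroup.closure S = ⊤) (a b c : Γ) :
    wordDist S a c ≤ wordDist S a b + wordDist S b c :=
  (mulCayley_connected hS).dist_triangle

theorem wordDist_eq_zero_iff (hS : Subgroup.closure S = ⊤) {a b : Γ} :
    wordDist S a b = 0 ↔ a = b :=
  (mulCayley_connected hS).dist_eq_zero_iff

/-- Left translation, as an endomorphism of the Cayley graph. -/
def mulLeftHom (S : Set Γ) (g : Γ) : SimpleGraph.mulCayley S →g SimpleGraph.mulCayley S where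
  toFun x := g * x
  map_rel' h := SimpleGraph.mulCayley_adj_mul_iff_right.2 h

theorem wordDist_mul_left_le (hS : Subgroup.closure S = ⊤) (g a b : Γ) :
    wordDist S (g * a) (g * b) ≤ wordDist S a b := by
  obtain ⟨w, hw⟩ := (mulCayley_connected hS).exists_walk_length_eq_dist a b
  rw [wordDist, wordDist, ← hw, ← SimpleGraph.Walk.length_map (mulLeftHom S g) w]
  exact SimpleGraph.dist_le _

theorem wordDist_mul_left (hS : Subgroup.closure S = ⊤) (g a b : Γ) :
    wordDist S (g * a) (g * b) = wordDist S a b := by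
  refine le_antisymm (wordDist_mul_left_le hS g a b) ?_
  simpa using wordDist_mul_left_le hS g⁻¹ (g * a) (g * b)

theorem wordDist_one_le_of_mem {s : Γ} (hs : s ∈ S) : wordDist S 1 s ≤ 1 := by
  by_cases h : 1 = s
  · rw [← h, wordDist_self]; exact zero_le_one
  · exact (SimpleGraph.dist_eq_one_iff_adj.2
      ((SimpleGraph.mulCayley_adj S _ _).2 ⟨h, by simp [hs]⟩)).le

theorem IsGeodesic.wordDist_getVert (hS : Subgroup.closure S = ⊤) {a b : Γ}
    {w : (SimpleGraph.mulCayley S).Walk a b} (hw : IsGeodesic w) {t : ℕ}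
    (ht : t ≤ wordDist S a b) :
    wordDist S a (w.getVert t) = t ∧ wordDist S (w.getVert t) b = wordDist S a b - t := by
  have h1 : wordDist S a (w.getVert t) ≤ t := by
    refine (SimpleGraph.dist_le (w.take t)).trans ?_
    rw [SimpleGraph.Walk.take_length]
    exact min_le_left _ _
  have h2 : wordDist S (w.getVert t) b ≤ wordDist S a b - t := by
    refine (SimpleGraph.dist_le (w.drop t)).trans ?_
    rw [SimpleGraph.Walk.drop_length, hw]
  have h3 := wordDist_triangle hS a (w.getVert t) b
  omega

theorem TrianglesFine.wordDist_getVert_le {δ : ℕ} (hδ : TrianglesFine S (δ : ℝ)) {a b c : Γ}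
    {α : (SimpleGraph.mulCayley S).Walk a b} {β : (SimpleGraph.mulCayley S).Walk a c}
    (hα : IsGeodesic α) (hβ : IsGeodesic β) {t : ℕ}
    (ht : 2 * t + wordDist S b c ≤ wordDist S a b + wordDist S a c) :
    wordDist S (α.getVert t) (β.getVert t) ≤ δ := by
  have h := hδ a b c α β hα hβ t (by
    have : (2 * t + wordDist S b c : ℝ) ≤ wordDist S a b + wordDist S a c := by exact_mod_cast ht
    unfold gromovProduct
    linarith)
  exact_mod_cast h

/-- Choose a geodesic from 1 to each element and translate it: q[a,b] is a times the geodesic to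
a⁻¹b, and a⁻¹b is invariant under left translation of the pair. -/
theorem exists_equivariantGeodesicBicombing (hS : Subgroup.closure S = ⊤) :
    Nonempty (EquivariantGeodesicBicombing S) := by
  choose w hw using fun g : Γ => (mulCayley_connected hS).exists_walk_length_eq_dist 1 g
  have e : ∀ a b : Γ, mulLeftHom S a 1 = a ∧ mulLeftHom S a (a⁻¹ * b) = b := fun a b =>
    ⟨mul_one a, mul_inv_cancel_left a b⟩
  refine ⟨⟨fun a b => ((w (a⁻¹ * b)).map (mulLeftHom S a)).copy (e a b).1 (e a b).2, ?_, ?_⟩⟩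
  · intro a b
    rw [IsGeodesic, SimpleGraph.Walk.length_copy, SimpleGraph.Walk.length_map, hw]
    have := wordDist_mul_left hS a 1 (a⁻¹ * b)
    simpa [wordDist] using this.symm
  · intro g a b t
    have e2 : (g * a)⁻¹ * (g * b) = a⁻¹ * b := by group
    -- The endpoint y is kept general so that `subst` can remove the transport along endpoint
    -- equalities.
    have key : ∀ (x y z : Γ) (c : (SimpleGraph.mulCayley S).Walk 1 z) (h1 : mulLeftHom S x 1 = x)
        (h2 : mulLeftHom S x z = y), ((c.map (mulLeftHom S x)).copy h1 h2).getVert t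
          = x * c.getVert t := by
      intro x y z c h1 h2
      subst h2
      rw [SimpleGraph.Walk.getVert_copy, SimpleGraph.Walk.getVert_map]
      rfl
    rw [key, key, e2, mul_assoc]

open scoped Pointwise in
-- Elements of length at most n are products of n factors from {1} ∪ S ∪ S⁻¹. This exponential bound
-- later determines p.
theorem exists_card_ball_le (hfin : S.Finite) (hS : Subgroup.closure S = ⊤) :
    ∃ K : ℕ, 1 ≤ K ∧ ∀ n : ℕ, {x | wordDist S 1 x ≤ n}.Finite ∧
      {x | wordDist S 1 x ≤ n}.ncard ≤ K ^ n := by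
  classical
  set T : Finset Γ := insert 1 (hfin.toFinset ∪ hfin.toFinset⁻¹) with hT
  have hT1 : (1 : Γ) ∈ T := by simp [hT]
  have hsub : ∀ n : ℕ, ∀ x, wordDist S 1 x ≤ n → x ∈ T ^ n := by
    intro n
    induction n with
    | zero =>
      intro x hx
      have := (wordDist_eq_zero_iff hS).1 (Nat.le_zero.1 hx)
      simp [← this]
    | succ n ih =>
      intro x hx
      rcases Nat.lt_or_ge (wordDist S 1 x) (n + 1) with h | h
      · rw [pow_succ]
        simpa using Finset.mul_mem_mul (ih x (by omega)) hT1
      obtain ⟨w, hw⟩ := (mulCayley_connected hS).exists_walk_length_eq_dist 1 x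
      have hwg : IsGeodesic w := hw
      have hl : w.length = n + 1 := hw.trans (le_antisymm hx h)
      have h1 := (hwg.wordDist_getVert hS (t := n) (by omega)).1
      have hadj := w.adj_getVert_succ (i := n) (by omega)
      rw [← hl, w.getVert_length] at hadj
      have := ((SimpleGraph.mulCayley_adj S _ _).1 hadj).2
      rw [pow_succ, ← mul_inv_cancel_left (w.getVert n) x]
      refine Finset.mul_mem_mul (ih _ h1.le) ?_
      simp only [hT, Finset.mem_insert, Finset.mem_union, Finset.mem_inv', Set.Finite.mem_toFinset]
      right
      simpa using this
  refine ⟨T.card, Finset.card_pos.2 ⟨1, hT1⟩, fun n => ?_⟩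
  have hs : {x | wordDist S 1 x ≤ n} ⊆ ↑(T ^ n) := fun x hx => hsub n x hx
  refine ⟨(Finset.finite_toSet _).subset hs, ?_⟩
  calc _ ≤ (↑(T ^ n) : Set Γ).ncard := Set.ncard_le_ncard hs (Finset.finite_toSet _)
    _ = (T ^ n).card := Set.ncard_coe_finset _
    _ ≤ _ := Finset.card_pow_le

theorem ball_eq_image (hS : Subgroup.closure S = ⊤) (a : Γ) (n : ℕ) :
    {x | wordDist S a x ≤ n} = (a * ·) '' {x | wordDist S 1 x ≤ n} := by
  ext x
  constructor
  · intro hx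
    refine ⟨a⁻¹ * x, ?_, mul_inv_cancel_left a x⟩
    have h := wordDist_mul_left hS a⁻¹ a x
    rw [inv_mul_cancel] at h
    exact h.trans_le hx
  · rintro ⟨y, hy, rfl⟩
    have h := wordDist_mul_left hS a 1 y
    rw [mul_one] at h
    exact h.trans_le hy

theorem ncard_ball (hS : Subgroup.closure S = ⊤) (a : Γ) (n : ℕ) :
    {x | wordDist S a x ≤ n}.ncard = {x | wordDist S 1 x ≤ n}.ncard := by
  rw [ball_eq_image hS a n, Set.ncard_image_of_injective _ (mul_right_injective a)]

theorem finite_ball (hfin : S.Finite) (hS : Subgroup.closure S = ⊤) (a : Γ) (n : ℕ) :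
    {x | wordDist S a x ≤ n}.Finite := by
  obtain ⟨K, -, hK⟩ := exists_card_ball_le hfin hS
  rw [ball_eq_image hS a n]
  exact (hK n).1.image _

end Metric

/-! ### Probability chains with prescribed support -/

section ProbabilityChains

variable {Γ : Type u}

/-- The rational probability chains supported in `B`. -/
def probabilityChains (B : Set Γ) : Set (Γ →₀ ℚ) :=
  {c | (∀ x, 0 ≤ c x) ∧ (∀ x, c x ≠ 0 → x ∈ B) ∧
    Finsupp.linearCombination ℚ (fun _ : Γ => (1 : ℚ)) c = 1}

/-- Mineyev's recursion only averages, so convexity carries support conditions through it. -/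
theorem convex_probabilityChains (B : Set Γ) : Convex ℚ (probabilityChains B) := by
  rintro c ⟨hc0, hcB, hc1⟩ d ⟨hd0, hdB, hd1⟩ s t hs ht hst
  refine ⟨fun x => ?_, fun x hx => ?_, ?_⟩
  · simpa using add_nonneg (mul_nonneg hs (hc0 x)) (mul_nonneg ht (hd0 x))
  · by_contra hB
    have h1 : c x = 0 := by_contra fun h => hB (hcB x h)
    have h2 : d x = 0 := by_contra fun h => hB (hdB x h)
    simp [h1, h2] at hx
  · simp [map_add, hc1, hd1, hst]

theorem single_mem_probabilityChains {B : Set Γ} {b : Γ} (hb : b ∈ B) :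
    Finsupp.single b (1 : ℚ) ∈ probabilityChains B := by
  classical
  refine ⟨fun x => ?_, fun x hx => ?_, by simp⟩
  · rw [Finsupp.single_apply]; split_ifs <;> norm_num
  · rw [Finsupp.single_apply] at hx
    split_ifs at hx with h
    · exact h ▸ hb
    · exact absurd rfl hx

end ProbabilityChains

/-! ### Mineyev's chains: supports, equivariance, averaging -/

section Chain

variable {Γ : Type u} [Group Γ] {S : Set Γ}

theorem mem_flower_self (δ : ℕ) (a b : Γ) : b ∈ flower S δ a b :=
  ⟨rfl, by simp [wordDist_self]⟩

theorem finite_flower (hfin : S.Finite) (hS : Subgroup.closure S = ⊤) (δ : ℕ) (a b : Γ) :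
    (flower S δ a b).Finite :=
  (finite_ball hfin hS b δ).subset fun _ hx => hx.2

theorem mineyevChain_of_le (q : EquivariantGeodesicBicombing S) {δ : ℕ} {a b : Γ}
    (h : wordDist S a b ≤ 10 * δ) : mineyevChain q δ a b = Finsupp.single b 1 := by
  rw [mineyevChain, if_pos h]

theorem mineyevChain_of_dvd (hfin : S.Finite) (hS : Subgroup.closure S = ⊤)
    (q : EquivariantGeodesicBicombing S) {δ : ℕ} {a b : Γ}
    (h : 10 * δ < wordDist S a b) (hd : 10 * δ ∣ wordDist S a b) :
    mineyevChain q δ a b = ∑ y ∈ (finite_flower hfin hS δ a b).toFinset,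
      (((finite_flower hfin hS δ a b).toFinset.card : ℚ)⁻¹) • mineyevChain q δ a (proj q δ a y) := by
  rw [mineyevChain, if_neg (by omega), if_neg (not_not.2 hd), ← Finset.smul_sum]
  congr 1
  · rw [← Set.ncard_eq_toFinset_card _ (finite_flower hfin hS δ a b)]
    rfl
  · rw [finsum_set_coe_eq_finsum_mem (f := fun y => mineyevChain q δ a (proj q δ a y)),
      finsum_mem_eq_finite_toFinset_sum _ (finite_flower hfin hS δ a b)]

/-- With the level rounded down, one formula covers both cases: on a multiple of 10δ the vertex is b
itself, elsewhere it is the projection of b. -/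
theorem mineyevChain_eq_getVert (q : EquivariantGeodesicBicombing S) {δ : ℕ} (hδ : 1 ≤ δ) {a b : Γ}
    (h : 10 * δ ≤ wordDist S a b) :
    mineyevChain q δ a b = mineyevChain q δ a
      ((q.path a b).getVert (10 * δ * (wordDist S a b / (10 * δ)))) := by
  by_cases hd : 10 * δ ∣ wordDist S a b
  · have h1 : (q.path a b).length = wordDist S a b := q.geodesic a b
    rw [Nat.mul_div_cancel' hd, ← h1, SimpleGraph.Walk.getVert_length]
  · rw [mineyevChain, if_neg (fun h' => hd (by rw [le_antisymm h' h])), if_pos hd]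
    have hne : b ≠ a := by
      rintro rfl
      rw [wordDist_self] at h
      omega
    have : (wordDist S a b - 1) / (10 * δ) = wordDist S a b / (10 * δ) := by
      obtain ⟨n, hn⟩ : ∃ n, wordDist S a b = n + 1 := ⟨wordDist S a b - 1, by omega⟩
      rw [hn] at hd ⊢
      rw [Nat.succ_div_of_not_dvd hd, Nat.add_sub_cancel]
    rw [proj, if_neg hne, this]

/-- The strict inequality in the definition of pr_a matters here: a point on level k + 1 drops to
level k and does not stay put. -/
theorem proj_eq_getVert (q : EquivariantGeodesicBicombing S) {δ : ℕ} (hδ : 1 ≤ δ) {a b : Γ} {k : ℕ}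
    (h : wordDist S a b = 10 * δ * (k + 1)) :
    proj q δ a b = (q.path a b).getVert (10 * δ * k) := by
  have hne : b ≠ a := by
    rintro rfl
    rw [wordDist_self, eq_comm, mul_eq_zero] at h
    omega
  have : (wordDist S a b - 1) / (10 * δ) = k := by
    rw [h, Nat.div_eq_iff (by omega)]
    have := Nat.mul_comm k (10 * δ)
    constructor
    · rw [this, Nat.mul_add]; omega
    · rw [this, Nat.mul_add]; omega
  rw [proj, if_neg hne, this]

theorem mineyevChain_mem_of_convex (hfin : S.Finite) (hS : Subgroup.closure S = ⊤)
    (q : EquivariantGeodesicBicombing S) {δ : ℕ} {a b : Γ}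
    (h : 10 * δ < wordDist S a b) (hd : 10 * δ ∣ wordDist S a b) {C : Set (Γ →₀ ℚ)}
    (hC : Convex ℚ C) (hmem : ∀ y ∈ flower S δ a b, mineyevChain q δ a (proj q δ a y) ∈ C) :
    mineyevChain q δ a b ∈ C := by
  rw [mineyevChain_of_dvd hfin hS q h hd]
  have hpos : (0 : ℚ) < ((finite_flower hfin hS δ a b).toFinset.card : ℚ) := by
    exact_mod_cast Finset.card_pos.2 ⟨b, by simpa using mem_flower_self δ a b⟩
  refine hC.sum_mem (fun _ _ => by positivity) ?_ (fun y hy => hmem y (by simpa using hy))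
  rw [Finset.sum_const, nsmul_eq_mul, mul_inv_cancel₀ hpos.ne']

theorem mineyevChain_mem_probabilityChains_ball (hfin : S.Finite) (hS : Subgroup.closure S = ⊤)
    (q : EquivariantGeodesicBicombing S) (δ : ℕ) (a b : Γ) :
    mineyevChain q δ a b ∈ probabilityChains {x | wordDist S a x ≤ 10 * δ} := by
  induction hn : wordDist S a b using Nat.strong_induction_on generalizing b with
  | _ n ih =>
    rcases le_or_gt (wordDist S a b) (10 * δ) with h | h
    · rw [mineyevChain_of_le q h]
      exact single_mem_probabilityChains h
    by_cases hd : 10 * δ ∣ wordDist S a b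
    · refine mineyevChain_mem_of_convex hfin hS q h hd (convex_probabilityChains _) fun y hy => ?_
      refine ih _ ?_ _ rfl
      rw [← hn, ← hy.1]
      exact wordDist_proj_lt q δ a y (by rw [hy.1]; omega)
    · rw [mineyevChain, if_neg (by omega), if_pos hd]
      refine ih _ ?_ _ rfl
      rw [← hn]
      exact wordDist_proj_lt q δ a b (by omega)

/-- The excess of z over a geodesic from a to b does not accumulate: a flower adds at most δ, but
the projection falls within δ of q[a,b], which resets the excess to at most δ. -/
theorem mineyevChain_mem_of_level (hfin : S.Finite) (hS : Subgroup.closure S = ⊤)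
    (q : EquivariantGeodesicBicombing S) {δ : ℕ} (hδ : 1 ≤ δ) (hfine : TrianglesFine S (δ : ℝ))
    (a b : Γ) (k : ℕ) (z : Γ) (hz : wordDist S a z = 10 * δ * (k + 1))
    (hzb : wordDist S a z + wordDist S z b ≤ wordDist S a b + 2 * δ) :
    mineyevChain q δ a z ∈ probabilityChains
      {x | wordDist S a x = 10 * δ ∧ wordDist S x b + 10 * δ ≤ wordDist S a b + 2 * δ} := by
  induction k generalizing z with
  | zero =>
    have hz' : wordDist S a z = 10 * δ := by simpa using hz
    rw [mineyevChain_of_le q hz'.le]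
    refine single_mem_probabilityChains ⟨hz', by omega⟩
  | succ k ih =>
    have e : 10 * δ * (k + 1 + 1) = 10 * δ * (k + 1) + 10 * δ := by ring
    have e' : 10 * δ * (k + 1) = 10 * δ * k + 10 * δ := by ring
    refine mineyevChain_mem_of_convex hfin hS q (by omega) ⟨_, hz⟩
      (convex_probabilityChains _) fun y hy => ?_
    have hyd : wordDist S a y = 10 * δ * (k + 1 + 1) := hy.1.trans hz
    rw [proj_eq_getVert q hδ hyd]
    have h1 := ((q.geodesic a y).wordDist_getVert hS (t := 10 * δ * (k + 1)) (by omega)).1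
    have hyb : wordDist S y b ≤ δ + wordDist S z b := by
      have h2 := wordDist_triangle hS y z b
      have h3 := hy.2
      rw [wordDist_comm] at h3
      omega
    have hab := wordDist_triangle hS a b z
    rw [wordDist_comm b z] at hab
    -- The excess of y is at most 3δ, so the Gromov product of y and b at a is at least d(a,y) -
    -- 3δ/2, well above the level d(a,y) - 10δ.
    have h4 := hfine.wordDist_getVert_le (q.geodesic a y) (q.geodesic a b)
      (t := 10 * δ * (k + 1)) (by omega)
    have h5 := ((q.geodesic a b).wordDist_getVert hS (t := 10 * δ * (k + 1)) (by omega)).2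
    refine ih _ h1 ?_
    have h6 := wordDist_triangle hS ((q.path a y).getVert (10 * δ * (k + 1)))
      ((q.path a b).getVert (10 * δ * (k + 1))) b
    omega

theorem mineyevChain_mem_probabilityChains_sphere (hfin : S.Finite) (hS : Subgroup.closure S = ⊤)
    (q : EquivariantGeodesicBicombing S) {δ : ℕ} (hδ : 1 ≤ δ) (hfine : TrianglesFine S (δ : ℝ))
    {a b : Γ} (h : 10 * δ ≤ wordDist S a b) :
    mineyevChain q δ a b ∈ probabilityChains
      {x | wordDist S a x = 10 * δ ∧ wordDist S x b + 10 * δ ≤ wordDist S a b + 2 * δ} := by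
  rw [mineyevChain_eq_getVert q hδ h]
  obtain ⟨k, hk⟩ : ∃ k, wordDist S a b / (10 * δ) = k + 1 :=
    ⟨wordDist S a b / (10 * δ) - 1, by have := Nat.div_pos h (by omega); omega⟩
  have hle := Nat.mul_div_le (wordDist S a b) (10 * δ)
  have h1 := (q.geodesic a b).wordDist_getVert hS hle
  rw [hk] at h1 hle ⊢
  exact mineyevChain_mem_of_level hfin hS q hδ hfine a b k _ h1.1 (by omega)

theorem mul_mem_flower_iff (hS : Subgroup.closure S = ⊤) (δ : ℕ) (g a b x : Γ) :
    g * x ∈ flower S δ (g * a) (g * b) ↔ x ∈ flower S δ a b := by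
  simp [flower, wordDist_mul_left hS]

theorem proj_mul (hS : Subgroup.closure S = ⊤) (q : EquivariantGeodesicBicombing S) (δ : ℕ)
    (g a b : Γ) : proj q δ (g * a) (g * b) = g * proj q δ a b := by
  by_cases h : b = a
  · simp [proj, h]
  · simp [proj, h, wordDist_mul_left hS, q.equivariant]

theorem mineyevChain_mul (hfin : S.Finite) (hS : Subgroup.closure S = ⊤)
    (q : EquivariantGeodesicBicombing S) (δ : ℕ) (g a b : Γ) :
    mineyevChain q δ (g * a) (g * b) = (mineyevChain q δ a b).mapDomain (g * ·) := by
  induction hn : wordDist S a b using Nat.strong_induction_on generalizing b with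
  | _ n ih =>
    have hg := wordDist_mul_left hS g a b
    rcases le_or_gt (wordDist S a b) (10 * δ) with h | h
    · rw [mineyevChain_of_le q h, mineyevChain_of_le q (by omega), Finsupp.mapDomain_single]
    by_cases hd : 10 * δ ∣ wordDist S a b
    · have himg : (finite_flower hfin hS δ (g * a) (g * b)).toFinset =
          (finite_flower hfin hS δ a b).toFinset.map (Equiv.mulLeft g).toEmbedding := by
        ext y
        simp only [Set.Finite.mem_toFinset, Finset.mem_map_equiv, Equiv.mulLeft_symm,
          Equiv.coe_mulLeft]
        rw [← mul_mem_flower_iff hS δ g a b, mul_inv_cancel_left]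
      rw [mineyevChain_of_dvd hfin hS q h hd,
        mineyevChain_of_dvd hfin hS q (by omega) (by rwa [hg]), himg, Finset.sum_map,
        Finset.card_map, Finsupp.mapDomain_finsetSum]
      refine Finset.sum_congr rfl fun y hy => ?_
      have hy' : y ∈ flower S δ a b := by simpa using hy
      rw [Finsupp.mapDomain_smul, Equiv.coe_toEmbedding, Equiv.coe_mulLeft, proj_mul hS]
      congr 1
      refine ih _ ?_ _ rfl
      rw [← hn, ← hy'.1]
      exact wordDist_proj_lt q δ a y (by rw [hy'.1]; omega)
    · rw [mineyevChain, if_neg (by omega), if_pos (by rwa [hg]), proj_mul hS,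
        mineyevChain.eq_def q δ a b, if_neg (by omega), if_pos hd]
      refine ih _ ?_ _ rfl
      rw [← hn]
      exact wordDist_proj_lt q δ a b (by omega)

/-- The difference is an average over the pairs in A × B. The pair (z,z) contributes zero, and its
weight is at least 1/N². -/
theorem abs_average_sub_average_le {ι : Type*} {A B : Finset ι} {z : ι} (hzA : z ∈ A) (hzB : z ∈ B)
    {N : ℕ} (hA : A.card ≤ N) (hB : B.card ≤ N) (G : ι → ℝ) {M : ℝ}
    (hM : ∀ y ∈ A, ∀ y' ∈ B, |G y - G y'| ≤ M) :
    |(A.card : ℝ)⁻¹ * ∑ y ∈ A, G y - (B.card : ℝ)⁻¹ * ∑ y ∈ B, G y| ≤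
      (1 - ((N : ℝ) ^ 2)⁻¹) * M := by
  classical
  have hA0 : (0 : ℝ) < A.card := by exact_mod_cast Finset.card_pos.2 ⟨z, hzA⟩
  have hB0 : (0 : ℝ) < B.card := by exact_mod_cast Finset.card_pos.2 ⟨z, hzB⟩
  have hA' : (A.card : ℝ) ≤ N := by exact_mod_cast hA
  have hB' : (B.card : ℝ) ≤ N := by exact_mod_cast hB
  have hM0 : 0 ≤ M := (abs_nonneg _).trans (hM z hzA z hzB)
  have e : (A.card : ℝ)⁻¹ * ∑ y ∈ A, G y - (B.card : ℝ)⁻¹ * ∑ y ∈ B, G y =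
      ((A.card : ℝ) * B.card)⁻¹ * ∑ w ∈ A ×ˢ B, (G w.1 - G w.2) := by
    rw [Finset.sum_product]
    simp only [Finset.sum_sub_distrib, Finset.sum_const, nsmul_eq_mul, ← Finset.mul_sum]
    field_simp
  have hsum : |∑ w ∈ A ×ˢ B, (G w.1 - G w.2)| ≤ ((A.card : ℝ) * B.card - 1) * M := by
    have hz : (z, z) ∈ A ×ˢ B := Finset.mk_mem_product hzA hzB
    rw [← Finset.add_sum_erase _ _ hz, sub_self, zero_add]
    refine (Finset.abs_sum_le_sum_abs _ _).trans ((Finset.sum_le_card_nsmul _ _ M ?_).trans_eq ?_)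
    · intro w hw
      have := Finset.mem_product.1 (Finset.mem_of_mem_erase hw)
      exact hM _ this.1 _ this.2
    · have h1 : 1 ≤ A.card * B.card := Nat.mul_pos (Finset.card_pos.2 ⟨z, hzA⟩)
        (Finset.card_pos.2 ⟨z, hzB⟩)
      rw [Finset.card_erase_of_mem hz, Finset.card_product, nsmul_eq_mul, Nat.cast_sub h1]
      push_cast
      ring
  rw [e, abs_mul, abs_of_pos (by positivity)]
  calc _ ≤ ((A.card : ℝ) * B.card)⁻¹ * (((A.card : ℝ) * B.card - 1) * M) := by gcongr
    _ = (1 - ((A.card : ℝ) * B.card)⁻¹) * M := by field_simp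
    _ ≤ _ := by
      gcongr
      nlinarith

end Chain

/-! ### Exponential contraction of the chains -/

section Contraction

variable {Γ : Type u} [Group Γ] {S : Set Γ}

theorem mineyevChain_apply_of_dvd (hfin : S.Finite) (hS : Subgroup.closure S = ⊤)
    (q : EquivariantGeodesicBicombing S) {δ : ℕ} {a b : Γ}
    (h : 10 * δ < wordDist S a b) (hd : 10 * δ ∣ wordDist S a b) (x : Γ) :
    (mineyevChain q δ a b x : ℝ) = ((finite_flower hfin hS δ a b).toFinset.card : ℝ)⁻¹ *
      ∑ y ∈ (finite_flower hfin hS δ a b).toFinset, (mineyevChain q δ a (proj q δ a y) x : ℝ) := by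
  rw [mineyevChain_of_dvd hfin hS q h hd, ← Finset.smul_sum, Finsupp.smul_apply,
    Finsupp.finsetSum_apply]
  push_cast [smul_eq_mul]
  rfl

theorem apply_le_one_of_mem_probabilityChains {α : Type*} {B : Set α} {c : α →₀ ℚ}
    (hc : c ∈ probabilityChains B) (x : α) : c x ≤ 1 := by
  classical
  by_cases hx : x ∈ c.support
  · rw [← hc.2.2, Finsupp.linearCombination_apply, Finsupp.sum]
    simpa using Finset.single_le_sum (f := fun y => c y) (fun y _ => hc.1 y) hx
  · rw [Finsupp.notMem_support_iff.1 hx]; exact zero_le_one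

theorem abs_mineyevChain_sub_le_one (hfin : S.Finite) (hS : Subgroup.closure S = ⊤)
    (q : EquivariantGeodesicBicombing S) (δ : ℕ) (a b b' x : Γ) :
    |(mineyevChain q δ a b x : ℝ) - mineyevChain q δ a b' x| ≤ 1 := by
  have h := mineyevChain_mem_probabilityChains_ball hfin hS q δ a b
  have h' := mineyevChain_mem_probabilityChains_ball hfin hS q δ a b'
  have h0 : (0 : ℝ) ≤ mineyevChain q δ a b x := by exact_mod_cast h.1 x
  have h1 : (mineyevChain q δ a b x : ℝ) ≤ 1 := by
    exact_mod_cast apply_le_one_of_mem_probabilityChains h x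
  have h0' : (0 : ℝ) ≤ mineyevChain q δ a b' x := by exact_mod_cast h'.1 x
  have h1' : (mineyevChain q δ a b' x : ℝ) ≤ 1 := by
    exact_mod_cast apply_le_one_of_mem_probabilityChains h' x
  rw [abs_le]
  constructor <;> linarith

/-- The point b lies in both flowers. Points of the two flowers are at most 3δ apart, so their
projections, 10δ lower, are again within δ of each other and the induction continues. -/
theorem abs_mineyevChain_sub_le_of_level (hfin : S.Finite) (hS : Subgroup.closure S = ⊤)
    (q : EquivariantGeodesicBicombing S) {δ N : ℕ} (hδ : 1 ≤ δ) (hfine : TrianglesFine S (δ : ℝ))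
    (hN : {x | wordDist S 1 x ≤ δ}.ncard ≤ N) (a x : Γ) (k : ℕ) {b b' : Γ}
    (hb : wordDist S a b = 10 * δ * (k + 1)) (hb' : wordDist S a b' = 10 * δ * (k + 1))
    (hbb' : wordDist S b b' ≤ δ) :
    |(mineyevChain q δ a b x : ℝ) - mineyevChain q δ a b' x| ≤ (1 - ((N : ℝ) ^ 2)⁻¹) ^ k := by
  induction k generalizing b b' with
  | zero => simpa using abs_mineyevChain_sub_le_one hfin hS q δ a b b' x
  | succ k ih =>
    have e : 10 * δ * (k + 1 + 1) = 10 * δ * (k + 1) + 10 * δ := by ring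
    have e' : 10 * δ * (k + 1) = 10 * δ * k + 10 * δ := by ring
    have hcard : ∀ c : Γ, (finite_flower hfin hS δ a c).toFinset.card ≤ N := by
      intro c
      rw [← Set.ncard_eq_toFinset_card _ (finite_flower hfin hS δ a c)]
      refine (Set.ncard_le_ncard (fun y hy => hy.2) (finite_ball hfin hS c δ)).trans ?_
      rwa [ncard_ball hS]
    rw [mineyevChain_apply_of_dvd hfin hS q (by omega) ⟨_, hb⟩ x,
      mineyevChain_apply_of_dvd hfin hS q (by omega) ⟨_, hb'⟩ x, pow_succ']
    refine abs_average_sub_average_le (z := b) (by simpa using mem_flower_self δ a b) ?_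
      (hcard b) (hcard b') (fun y => (mineyevChain q δ a (proj q δ a y) x : ℝ)) ?_
    · rw [Set.Finite.mem_toFinset]
      exact ⟨hb.trans hb'.symm, by rwa [wordDist_comm]⟩
    · intro y hy y' hy'
      rw [Set.Finite.mem_toFinset] at hy hy'
      have hyd : wordDist S a y = 10 * δ * (k + 1 + 1) := hy.1.trans hb
      have hyd' : wordDist S a y' = 10 * δ * (k + 1 + 1) := hy'.1.trans hb'
      rw [proj_eq_getVert q hδ hyd, proj_eq_getVert q hδ hyd']
      have h1 := ((q.geodesic a y).wordDist_getVert hS (t := 10 * δ * (k + 1)) (by omega)).1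
      have h1' := ((q.geodesic a y').wordDist_getVert hS (t := 10 * δ * (k + 1)) (by omega)).1
      have t1 := wordDist_triangle hS y b y'
      have t2 := wordDist_triangle hS b b' y'
      have t3 := hy.2
      have t4 := hy'.2
      rw [wordDist_comm] at t3
      exact ih h1 h1' (hfine.wordDist_getVert_le (q.geodesic a y) (q.geodesic a y') (by omega))

theorem abs_average_sub_le {ι : Type*} {A : Finset ι} (hA : A.Nonempty) (G : ι → ℝ) {r M : ℝ}
    (hM : ∀ y ∈ A, |G y - r| ≤ M) : |(A.card : ℝ)⁻¹ * ∑ y ∈ A, G y - r| ≤ M := by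
  have hA0 : (0 : ℝ) < A.card := by exact_mod_cast hA.card_pos
  have e : (A.card : ℝ)⁻¹ * ∑ y ∈ A, G y - r = (A.card : ℝ)⁻¹ * ∑ y ∈ A, (G y - r) := by
    rw [Finset.sum_sub_distrib, Finset.sum_const, nsmul_eq_mul]
    field_simp
  rw [e, abs_mul, abs_of_pos (by positivity), inv_mul_le_iff₀ hA0, ← nsmul_eq_mul]
  exact (Finset.abs_sum_le_sum_abs _ _).trans (Finset.sum_le_card_nsmul _ _ M hM)

/-- Here b sits on a level and b' just below it, so only b is averaged over a flower. All the
projections meet on the next lower level within δ of each other; this step yields no contraction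
factor. -/
theorem abs_mineyevChain_sub_le_of_succ (hfin : S.Finite) (hS : Subgroup.closure S = ⊤)
    (q : EquivariantGeodesicBicombing S) {δ N : ℕ} (hδ : 1 ≤ δ) (hfine : TrianglesFine S (δ : ℝ))
    (hN : {x | wordDist S 1 x ≤ δ}.ncard ≤ N) (a x : Γ) (k : ℕ) {b b' : Γ}
    (hb : wordDist S a b = 10 * δ * (k + 1 + 1)) (hb' : wordDist S a b' + 1 = wordDist S a b)
    (hbb' : wordDist S b b' ≤ 1) :
    |(mineyevChain q δ a b x : ℝ) - mineyevChain q δ a b' x| ≤ (1 - ((N : ℝ) ^ 2)⁻¹) ^ k := by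
  have e : 10 * δ * (k + 1 + 1) = 10 * δ * (k + 1) + 10 * δ := by ring
  have e' : 10 * δ * (k + 1) = 10 * δ * k + 10 * δ := by ring
  have hdiv : wordDist S a b' / (10 * δ) = k + 1 := by
    rw [Nat.div_eq_iff (by omega), mul_comm (k + 1)]
    constructor <;> omega
  rw [mineyevChain_apply_of_dvd hfin hS q (by omega) ⟨_, hb⟩ x,
    mineyevChain_eq_getVert q hδ (b := b') (by omega), hdiv]
  refine abs_average_sub_le ⟨b, by simpa using mem_flower_self δ a b⟩
    (fun y => (mineyevChain q δ a (proj q δ a y) x : ℝ)) fun y hy => ?_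
  rw [Set.Finite.mem_toFinset] at hy
  have hyd : wordDist S a y = 10 * δ * (k + 1 + 1) := hy.1.trans hb
  rw [proj_eq_getVert q hδ hyd]
  have h1 := ((q.geodesic a y).wordDist_getVert hS (t := 10 * δ * (k + 1)) (by omega)).1
  have h1' := ((q.geodesic a b').wordDist_getVert hS (t := 10 * δ * (k + 1)) (by omega)).1
  have t1 := wordDist_triangle hS y b b'
  have t2 := hy.2
  rw [wordDist_comm] at t2
  exact abs_mineyevChain_sub_le_of_level hfin hS q hδ hfine hN a x k h1 h1'
    (hfine.wordDist_getVert_le (q.geodesic a y) (q.geodesic a b') (by omega))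

/-- Of the levels below b, one is spent on the trivial bound at the bottom and one when b and b'
straddle a multiple of 10δ; hence the exponent with -2, truncated at 0. -/
theorem abs_mineyevChain_sub_le (hfin : S.Finite) (hS : Subgroup.closure S = ⊤)
    (q : EquivariantGeodesicBicombing S) {δ N : ℕ} (hδ : 1 ≤ δ) (hfine : TrianglesFine S (δ : ℝ))
    (hN : {x | wordDist S 1 x ≤ δ}.ncard ≤ N) (hN1 : 1 ≤ N) (a x : Γ) {b b' : Γ}
    (hbb' : wordDist S b b' ≤ 1) :
    |(mineyevChain q δ a b x : ℝ) - mineyevChain q δ a b' x| ≤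
      (1 - ((N : ℝ) ^ 2)⁻¹) ^ (wordDist S a b / (10 * δ) - 2) := by
  have hN' : (1 : ℝ) ≤ (N : ℝ) ^ 2 := one_le_pow₀ (by exact_mod_cast hN1)
  have hl0 : (0 : ℝ) ≤ 1 - ((N : ℝ) ^ 2)⁻¹ := sub_nonneg.2 (inv_le_one_of_one_le₀ hN')
  have hl1 : 1 - ((N : ℝ) ^ 2)⁻¹ ≤ 1 := sub_le_self _ (by positivity)
  obtain ⟨m, hm⟩ : ∃ m, wordDist S a b / (10 * δ) = m := ⟨_, rfl⟩
  rw [hm]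
  rcases Nat.lt_or_ge m 2 with hm2 | hm2
  · rw [Nat.sub_eq_zero_of_le hm2.le, pow_zero]
    exact abs_mineyevChain_sub_le_one hfin hS q δ a b b' x
  obtain ⟨k, rfl⟩ : ∃ k, m = k + 2 := ⟨m - 2, by omega⟩
  rw [Nat.add_sub_cancel]
  have e2 : 10 * δ * (k + 2) = 10 * δ * k + 10 * δ + 10 * δ := by ring
  have hm' := (Nat.div_eq_iff (by omega)).1 hm
  rw [mul_comm (k + 2), e2] at hm'
  have t1 := wordDist_triangle hS a b b'
  have t2 := wordDist_triangle hS a b' b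
  rw [wordDist_comm b' b] at t2
  rcases Nat.lt_trichotomy (wordDist S a b' / (10 * δ)) (k + 2) with h | h | h
  · have h' := (Nat.div_lt_iff_lt_mul (by omega)).1 h
    rw [mul_comm (k + 2), e2] at h'
    exact abs_mineyevChain_sub_le_of_succ hfin hS q hδ hfine hN a x k
      (by rw [show k + 1 + 1 = k + 2 from rfl, e2]; omega) (by omega) hbb'
  · have h' := (Nat.div_eq_iff (by omega)).1 h
    rw [mul_comm (k + 2), e2] at h'
    have hle := Nat.mul_div_le (wordDist S a b) (10 * δ)
    have hle' := Nat.mul_div_le (wordDist S a b') (10 * δ)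
    have g1 := ((q.geodesic a b).wordDist_getVert hS hle)
    have g1' := ((q.geodesic a b').wordDist_getVert hS hle')
    rw [mineyevChain_eq_getVert q hδ (b := b) (by omega),
      mineyevChain_eq_getVert q hδ (b := b') (by omega)]
    rw [hm] at g1 hle ⊢
    rw [h] at g1' hle' ⊢
    refine (abs_mineyevChain_sub_le_of_level hfin hS q hδ hfine hN a x (k + 1) g1.1 g1'.1
      ?_).trans (pow_le_pow_of_le_one hl0 hl1 k.le_succ)
    -- Fineness applies unless the level exceeds the Gromov product; as d(b,b') ≤ 1, that happens
    -- only if b and b' are themselves the level points.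
    by_cases hfit : 2 * (10 * δ * (k + 2)) + wordDist S b b' ≤ wordDist S a b + wordDist S a b'
    · exact hfine.wordDist_getVert_le (q.geodesic a b) (q.geodesic a b') hfit
    · have hz : wordDist S ((q.path a b).getVert (10 * δ * (k + 2))) b = 0 := by omega
      have hz' : wordDist S ((q.path a b').getVert (10 * δ * (k + 2))) b' = 0 := by omega
      rw [(wordDist_eq_zero_iff hS).1 hz, (wordDist_eq_zero_iff hS).1 hz']
      omega
  · rw [abs_sub_comm]
    have e3 : 10 * δ * (k + 1 + 1 + 1) = 10 * δ * k + 10 * δ + 10 * δ + 10 * δ := by ring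
    have h3 : wordDist S a b' = 10 * δ * (k + 1 + 1 + 1) := by
      have := (Nat.le_div_iff_mul_le (by omega)).1 h
      rw [mul_comm (k + 2).succ, show (k + 2).succ = k + 1 + 1 + 1 from rfl] at this
      omega
    exact (abs_mineyevChain_sub_le_of_succ hfin hS q hδ hfine hN a x (k + 1) h3 (by omega)
      (by rwa [wordDist_comm])).trans (pow_le_pow_of_le_one hl0 hl1 k.le_succ)

end Contraction

/-! ### Normalization in the l^p-norm -/

section LpNorm

variable {α : Type*}

theorem chainLpNorm_eq_sum {p : ℝ} (hp : 0 < p) {c : α →₀ ℚ} {T : Finset α}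
    (hT : ∀ x, c x ≠ 0 → x ∈ T) : chainLpNorm p c = (∑ x ∈ T, |(c x : ℝ)| ^ p) ^ (1 / p) := by
  rw [chainLpNorm, Finsupp.sum_of_support_subset c (s := T)
    (fun x hx => hT x (Finsupp.mem_support_iff.1 hx))]
  intro x _
  simp [Real.zero_rpow hp.ne']

theorem chainLpNorm_rpow {p : ℝ} (hp : 0 < p) (c : α →₀ ℚ) :
    chainLpNorm p c ^ p = ∑ x ∈ c.support, |(c x : ℝ)| ^ p := by
  rw [chainLpNorm, Finsupp.sum, ← Real.rpow_mul (Finset.sum_nonneg fun _ _ => by positivity),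
    one_div_mul_cancel hp.ne', Real.rpow_one]

theorem chainLpNorm_nonneg (p : ℝ) (c : α →₀ ℚ) : 0 ≤ chainLpNorm p c :=
  Real.rpow_nonneg (Finset.sum_nonneg fun _ _ => by positivity) _

theorem abs_apply_le_chainLpNorm {p : ℝ} (hp : 0 < p) (c : α →₀ ℚ) (x : α) :
    |(c x : ℝ)| ≤ chainLpNorm p c := by
  by_cases hx : x ∈ c.support
  · rw [← Real.rpow_le_rpow_iff (abs_nonneg _) (chainLpNorm_nonneg p c) hp, chainLpNorm_rpow hp]
    exact Finset.single_le_sum (f := fun x => |(c x : ℝ)| ^ p) (fun _ _ => by positivity) hx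
  · rw [Finsupp.notMem_support_iff.1 hx]
    simpa using chainLpNorm_nonneg p c

/-- Total mass 1 on T forces a coefficient of at least 1/#T. This keeps the normalizing factors
bounded, uniformly in p. -/
theorem inv_card_le_chainLpNorm {p : ℝ} (hp : 0 < p) {T : Finset α} {c : α →₀ ℚ}
    (hc : c ∈ probabilityChains (T : Set α)) : (T.card : ℝ)⁻¹ ≤ chainLpNorm p c := by
  have hsum : ∑ x ∈ T, (c x : ℝ) = 1 := by
    have h := hc.2.2
    rw [Finsupp.linearCombination_apply, Finsupp.sum_of_support_subset c (s := T)
      (fun x hx => hc.2.1 x (Finsupp.mem_support_iff.1 hx)) _ (by simp)] at h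
    have h' : ∑ x ∈ T, c x = 1 := by simpa using h
    exact_mod_cast h'
  have hT : T.Nonempty := by
    rw [Finset.nonempty_iff_ne_empty]
    rintro rfl
    simp at hsum
  have h0 : (0 : ℝ) < T.card := by exact_mod_cast hT.card_pos
  rw [inv_le_iff_one_le_mul₀' h0, ← hsum, ← nsmul_eq_mul]
  exact Finset.sum_le_card_nsmul _ _ _ fun x _ =>
    (le_abs_self _).trans (abs_apply_le_chainLpNorm hp c x)

theorem chainLpNorm_le_add {p : ℝ} (hp : 1 ≤ p) {T : Finset α} {c c' : α →₀ ℚ}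
    (hc : ∀ x, c x ≠ 0 → x ∈ T) (hc' : ∀ x, c' x ≠ 0 → x ∈ T) {ε : ℝ} (hε : 0 ≤ ε)
    (h : ∀ x, |(c x : ℝ) - c' x| ≤ ε) :
    chainLpNorm p c ≤ chainLpNorm p c' + T.card * ε := by
  have hp0 : 0 < p := by linarith
  rw [chainLpNorm_eq_sum hp0 hc, chainLpNorm_eq_sum hp0 hc']
  have h1 := Real.Lp_add_le T (fun x => (c' x : ℝ)) (fun x => (c x : ℝ) - c' x) hp
  simp only [add_sub_cancel] at h1
  refine h1.trans ?_
  gcongr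
  have h2 : ∑ x ∈ T, |(c x : ℝ) - c' x| ^ p ≤ T.card * ε ^ p := by
    rw [← nsmul_eq_mul]
    exact Finset.sum_le_card_nsmul _ _ _ fun x _ => Real.rpow_le_rpow (abs_nonneg _) (h x) hp0.le
  calc _ ≤ ((T.card : ℝ) * ε ^ p) ^ (1 / p) :=
        Real.rpow_le_rpow (Finset.sum_nonneg fun _ _ => by positivity) h2 (by positivity)
    _ = (T.card : ℝ) ^ (1 / p) * ε := by
        rw [Real.mul_rpow (by positivity) (by positivity), ← Real.rpow_mul hε,
          mul_one_div_cancel hp0.ne', Real.rpow_one]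
    _ ≤ _ := by
        gcongr
        rcases T.eq_empty_or_nonempty with rfl | hT
        · simp [Real.zero_rpow (inv_ne_zero hp0.ne')]
        · calc (T.card : ℝ) ^ (1 / p) ≤ (T.card : ℝ) ^ (1 : ℝ) :=
                Real.rpow_le_rpow_of_exponent_le (by exact_mod_cast hT.card_pos)
                  ((div_le_one hp0).2 hp)
            _ = T.card := Real.rpow_one _

theorem abs_div_chainLpNorm_sub_le {p : ℝ} (hp : 1 ≤ p) {T : Finset α} {c c' : α →₀ ℚ}
    (hc : c ∈ probabilityChains (T : Set α)) (hc' : c' ∈ probabilityChains (T : Set α))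
    {ε : ℝ} (hε : 0 ≤ ε) (h : ∀ x, |(c x : ℝ) - c' x| ≤ ε) (x : α) :
    |(c x : ℝ) / chainLpNorm p c - c' x / chainLpNorm p c'| ≤ T.card * (T.card + 1) * ε := by
  have hp0 : 0 < p := by linarith
  have hT : (0 : ℝ) < T.card := by
    rcases T.eq_empty_or_nonempty with rfl | hT
    · have h0 : c = 0 := Finsupp.ext fun y => by_contra fun hy => by simpa using hc.2.1 y hy
      have := hc.2.2
      simp [h0] at this
    · exact_mod_cast hT.card_pos
  have hF := inv_card_le_chainLpNorm hp0 hc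
  have hF' := inv_card_le_chainLpNorm hp0 hc'
  have hF0 : 0 < chainLpNorm p c := lt_of_lt_of_le (by positivity) hF
  have hF0' : 0 < chainLpNorm p c' := lt_of_lt_of_le (by positivity) hF'
  have h1 := chainLpNorm_le_add hp hc.2.1 hc'.2.1 hε h
  have h2 := chainLpNorm_le_add hp hc'.2.1 hc.2.1 hε (fun x => by rw [abs_sub_comm]; exact h x)
  have hx' := abs_apply_le_chainLpNorm hp0 c' x
  generalize chainLpNorm p c = F at *
  generalize chainLpNorm p c' = F' at *
  have hdiff : |F' - F| ≤ T.card * ε := by rw [abs_le]; constructor <;> linarith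
  -- The change of the chain is separated from the change of its norm; then |c'(x)| ≤ F' and 1/F ≤
  -- #T suffice.
  have e : (c x : ℝ) / F - c' x / F' = (((c x : ℝ) - c' x) + c' x / F' * (F' - F)) * F⁻¹ := by
    field_simp
    ring
  have h3 : |(c' x : ℝ) / F'| ≤ 1 := by rwa [abs_div, abs_of_pos hF0', div_le_one hF0']
  have hFinv : |F⁻¹| ≤ T.card := by
    rw [abs_of_pos (by positivity)]
    exact inv_le_of_inv_le₀ hT hF
  rw [e, abs_mul]
  calc _ ≤ (ε + 1 * (T.card * ε)) * T.card := by
        gcongr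
        refine (abs_add_le _ _).trans (add_le_add (h x) ?_)
        rw [abs_mul]
        gcongr
    _ = _ := by ring

theorem sum_abs_div_chainLpNorm_rpow {p : ℝ} (hp : 0 < p) {B : Set α} {c : α →₀ ℚ}
    (hc : c ∈ probabilityChains B) :
    ∑ x ∈ c.support, |(c x : ℝ) / chainLpNorm p c| ^ p = 1 := by
  have hF0 : 0 < chainLpNorm p c :=
    lt_of_lt_of_le (by
      have : c.support.Nonempty := by
        rw [Finset.nonempty_iff_ne_empty, Ne, Finsupp.support_eq_empty]
        rintro rfl
        simpa using hc.2.2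
      have h : (0 : ℝ) < c.support.card := by exact_mod_cast this.card_pos
      positivity) (inv_card_le_chainLpNorm hp (T := c.support)
        ⟨hc.1, fun x hx => Finset.mem_coe.2 (Finsupp.mem_support_iff.2 hx), hc.2.2⟩)
  have h : ∀ x, |(c x : ℝ) / chainLpNorm p c| ^ p = |(c x : ℝ)| ^ p / chainLpNorm p c ^ p := by
    intro x
    rw [abs_div, abs_of_pos hF0, Real.div_rpow (abs_nonneg _) hF0.le]
  simp_rw [h]
  rw [← Finset.sum_div, ← chainLpNorm_rpow hp, div_self (by positivity)]

end LpNorm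

theorem summable_pow_of_card_le {α : Type*} {f : α → ℕ} {A L ρ : ℝ} (hA : 0 ≤ A) (hL : 0 ≤ L)
    (hρ : 0 ≤ ρ) (hρL : ρ * L < 1) (hfin : ∀ k, {x | f x ≤ k}.Finite)
    (hcard : ∀ k, ({x | f x ≤ k}.ncard : ℝ) ≤ A * L ^ k) : Summable fun x => ρ ^ f x := by
  classical
  have hgeo : Summable fun k : ℕ => A * (ρ * L) ^ k :=
    (summable_geometric_of_lt_one (by positivity) hρL).mul_left A
  refine summable_of_sum_le (c := ∑' k : ℕ, A * (ρ * L) ^ k) (fun x => by positivity) fun s => ?_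
  rw [Finset.sum_comp (fun k => ρ ^ k) f]
  refine le_trans (Finset.sum_le_sum fun k _ => ?_)
    (hgeo.sum_le_tsum (s.image f) (fun k _ => by positivity))
  have h1 : ((s.filter fun x => f x = k).card : ℝ) ≤ A * L ^ k := by
    refine le_trans ?_ (hcard k)
    have hsub : (↑(s.filter fun x => f x = k) : Set α) ⊆ {x | f x ≤ k} := fun x hx =>
      (Finset.mem_filter.1 (Finset.mem_coe.1 hx)).2.le
    rw [← Set.ncard_coe_finset]
    exact_mod_cast Set.ncard_le_ncard hsub (hfin k)
  rw [nsmul_eq_mul, mul_pow]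
  calc _ ≤ A * L ^ k * ρ ^ k := by gcongr
    _ = _ := by ring

/-! ### The cocycle π(g)η - η: integrability and growth -/

section Cocycle

variable {Γ : Type u} [Group Γ] {S : Set Γ}

theorem normalizedChain_mul (hfin : S.Finite) (hS : Subgroup.closure S = ⊤)
    (q : EquivariantGeodesicBicombing S) (δ : ℕ) (p : ℝ) (g a b x : Γ) :
    normalizedChain q δ p (g * a) (g * b) (g * x) = normalizedChain q δ p a b x := by
  have hinj : Function.Injective (g * · : Γ → Γ) := mul_right_injective g
  rw [normalizedChain, normalizedChain, mineyevChain_mul hfin hS]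
  congr 1
  · exact_mod_cast Finsupp.mapDomain_apply hinj _ x
  · rw [chainLpNorm, chainLpNorm, Finsupp.sum_mapDomain_index_inj hinj]

theorem eta_inv_mul (hfin : S.Finite) (hS : Subgroup.closure S = ⊤)
    (q : EquivariantGeodesicBicombing S) (δ : ℕ) (p : ℝ) (g γ x : Γ) :
    eta q δ p (g⁻¹ * γ, g⁻¹ * x) = normalizedChain q δ p γ g x := by
  have h := normalizedChain_mul hfin hS q δ p g⁻¹ γ g x
  rwa [inv_mul_cancel] at h

theorem mineyevChain_mem_toFinset (hfin : S.Finite) (hS : Subgroup.closure S = ⊤)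
    (q : EquivariantGeodesicBicombing S) (δ : ℕ) (a b : Γ) :
    mineyevChain q δ a b ∈
      probabilityChains ((finite_ball hfin hS a (10 * δ)).toFinset : Set Γ) := by
  rw [Set.Finite.coe_toFinset]
  exact mineyevChain_mem_probabilityChains_ball hfin hS q δ a b

theorem exists_memlp_eta_sub (hfin : S.Finite) (hS : Subgroup.closure S = ⊤)
    {δ : ℕ} (hδ : 1 ≤ δ) (hfine : TrianglesFine S (δ : ℝ)) (q : EquivariantGeodesicBicombing S) :
    ∃ p : ℕ, 3 ≤ p ∧ ∀ s ∈ S, Memℓp (E := fun _ : Γ × Γ => ℝ) (fun z : Γ × Γ =>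
      eta q δ p (s⁻¹ * z.1, s⁻¹ * z.2) - eta q δ p z) (p : ℝ≥0∞) := by
  obtain ⟨K, hK1, hK⟩ := exists_card_ball_le hfin hS
  -- The added 2 makes N > 1, hence lam > 0, so that powers of lam can be inverted.
  set N : ℕ := {x | wordDist S 1 x ≤ δ}.ncard + 2 with hN
  set lam : ℝ := 1 - ((N : ℝ) ^ 2)⁻¹ with hlam
  have hN2 : (2 : ℝ) ≤ N := by exact_mod_cast Nat.le_add_left 2 _
  have hlam0 : 0 < lam := by
    rw [hlam, sub_pos]
    exact inv_lt_one_of_one_lt₀ (by nlinarith)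
  have hlam1 : lam < 1 := sub_lt_self _ (by positivity)
  have hKpos : (0 : ℝ) < (K : ℝ) ^ (10 * δ) := by
    have : (0 : ℝ) < K := by exact_mod_cast hK1
    positivity
  -- K^(10δ) bounds the growth per level, and lam^n beats it. Taking p = n + 3 also secures p > 2.
  obtain ⟨n, hn⟩ := exists_pow_lt_of_lt_one (y := lam) (x := ((K : ℝ) ^ (10 * δ))⁻¹)
    (by positivity) hlam1
  refine ⟨n + 3, by omega, fun s hs => ?_⟩
  set p := n + 3 with hp
  set ρ : ℝ := lam ^ p with hρ
  have hρ0 : 0 < ρ := by positivity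
  have hρK : ρ * (K : ℝ) ^ (10 * δ) < 1 := by
    rw [← lt_inv_mul_iff₀' hKpos, mul_one]
    exact (pow_le_pow_of_le_one hlam0.le hlam1.le (by omega)).trans_lt hn
  have hD : 0 < 10 * δ := by omega
  have hsub : ∀ k, {x | wordDist S 1 x / (10 * δ) ≤ k} ⊆
      {x | wordDist S 1 x ≤ 10 * δ * (k + 1)} := by
    intro k x hx
    have h1 : wordDist S 1 x / (10 * δ) < k + 1 := Nat.lt_succ_of_le hx
    rw [Nat.div_lt_iff_lt_mul hD, mul_comm] at h1
    exact h1.le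
  have hsum : Summable fun γ : Γ => ρ ^ (wordDist S 1 γ / (10 * δ)) := by
    refine summable_pow_of_card_le (A := (K : ℝ) ^ (10 * δ)) (L := (K : ℝ) ^ (10 * δ)) hKpos.le
      hKpos.le hρ0.le hρK (fun k => (hK _).1.subset (hsub k)) fun k => ?_
    calc _ ≤ (({x | wordDist S 1 x ≤ 10 * δ * (k + 1)}.ncard : ℕ) : ℝ) := by
          exact_mod_cast Set.ncard_le_ncard (hsub k) (hK _).1
      _ ≤ (K : ℝ) ^ (10 * δ * (k + 1)) := by exact_mod_cast (hK _).2
      _ = _ := by rw [← pow_mul, ← pow_add]; ring_nf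
  set M : ℝ := ({x | wordDist S 1 x ≤ 10 * δ}.ncard : ℝ) with hM
  have hM0 : 0 ≤ M := Nat.cast_nonneg _
  have hTcard : ∀ γ : Γ, ((finite_ball hfin hS γ (10 * δ)).toFinset.card : ℝ) = M := by
    intro γ
    rw [← Set.ncard_eq_toFinset_card _ (finite_ball hfin hS γ (10 * δ)), ncard_ball hS]
  have hp1 : (1 : ℝ) ≤ (p : ℝ) := by exact_mod_cast (by omega : 1 ≤ p)
  set h : Γ → Γ → ℝ := fun γ x => normalizedChain q δ p γ s x - normalizedChain q δ p γ 1 x with hh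
  have hout : ∀ γ x, x ∉ (finite_ball hfin hS γ (10 * δ)).toFinset → h γ x = 0 := by
    intro γ x hx
    have z : ∀ b, mineyevChain q δ γ b x = 0 := fun b => by_contra fun hne =>
      hx ((mineyevChain_mem_toFinset hfin hS q δ γ b).2.1 x hne)
    simp [hh, normalizedChain, z]
  have hbd : ∀ γ x, |h γ x| ≤ M * (M + 1) * lam ^ (wordDist S 1 γ / (10 * δ) - 2) := by
    intro γ x
    have h1 := abs_div_chainLpNorm_sub_le hp1 (mineyevChain_mem_toFinset hfin hS q δ γ s)
      (mineyevChain_mem_toFinset hfin hS q δ γ 1)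
      (ε := lam ^ (wordDist S γ 1 / (10 * δ) - 2)) (by positivity)
      (fun x => by
        rw [abs_sub_comm]
        exact abs_mineyevChain_sub_le hfin hS q hδ hfine (by omega) (by omega) γ x
          (wordDist_one_le_of_mem hs)) x
    rwa [hTcard, wordDist_comm γ 1] at h1
  have hpow : ∀ γ x, |h γ x| ^ p ≤
      (M * (M + 1)) ^ p * (ρ ^ 2)⁻¹ * ρ ^ (wordDist S 1 γ / (10 * δ)) := by
    intro γ x
    -- With truncated subtraction this is only an inequality, valid because m ≤ 2 + (m - 2) and ρ ≤
    -- 1.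
    have h1 : ρ ^ (wordDist S 1 γ / (10 * δ) - 2) ≤ (ρ ^ 2)⁻¹ * ρ ^ (wordDist S 1 γ / (10 * δ)) := by
      rw [le_inv_mul_iff₀ (by positivity), ← pow_add]
      exact pow_le_pow_of_le_one hρ0.le (pow_le_one₀ hlam0.le hlam1.le) (by omega)
    calc |h γ x| ^ p ≤ (M * (M + 1) * lam ^ (wordDist S 1 γ / (10 * δ) - 2)) ^ p :=
          pow_le_pow_left₀ (abs_nonneg _) (hbd γ x) p
      _ = (M * (M + 1)) ^ p * ρ ^ (wordDist S 1 γ / (10 * δ) - 2) := by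
          rw [mul_pow, ← pow_mul, hρ, ← pow_mul, mul_comm p]
      _ ≤ _ := by rw [mul_assoc]; gcongr
  have hp0 : p ≠ 0 := by omega
  refine memℓp_gen ?_
  have e : (fun z : Γ × Γ => ‖eta q δ p (s⁻¹ * z.1, s⁻¹ * z.2) - eta q δ p z‖ ^
      ((p : ℝ≥0∞)).toReal) = fun z : Γ × Γ => |h z.1 z.2| ^ p := by
    funext ⟨γ, x⟩
    rw [ENNReal.toReal_natCast, Real.rpow_natCast, Real.norm_eq_abs, eta_inv_mul hfin hS]
    rfl
  rw [e, summable_prod_of_nonneg (fun z => by positivity)]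
  dsimp only
  have hz : ∀ γ x, x ∉ (finite_ball hfin hS γ (10 * δ)).toFinset → |h γ x| ^ p = 0 := by
    intro γ x hx
    rw [hout γ x hx, abs_zero, zero_pow hp0]
  refine ⟨fun γ => summable_of_ne_finset_zero (hz γ), ?_⟩
  refine Summable.of_nonneg_of_le (fun γ => tsum_nonneg fun x => by positivity) (fun γ => ?_)
    (hsum.mul_left (M * ((M * (M + 1)) ^ p * (ρ ^ 2)⁻¹)))
  rw [tsum_eq_sum (hz γ)]
  refine (Finset.sum_le_card_nsmul _ _ _ fun x _ => hpow γ x).trans_eq ?_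
  rw [nsmul_eq_mul, hTcard, ← mul_assoc]

/-- The vertices of q[1,g] at distance at least 10δ from both ends are distinct, and each
contributes at least 1 to the p-th power of the norm. -/
theorem card_le_norm_rpow (hfin : S.Finite) (hS : Subgroup.closure S = ⊤)
    {δ : ℕ} (hδ : 1 ≤ δ) (hfine : TrianglesFine S (δ : ℝ)) (q : EquivariantGeodesicBicombing S)
    {p : ℕ} (hp : 1 ≤ p) (g : Γ) (b : LpSquare Γ p)
    (hb : ∀ γ x, b (γ, x) = eta q δ p (g⁻¹ * γ, g⁻¹ * x) - eta q δ p (γ, x)) :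
    (wordDist S 1 g : ℝ) ≤ ‖b‖ ^ p + 20 * δ := by
  classical
  have hp0 : (0 : ℝ) < p := by exact_mod_cast hp
  set v : ℕ → Γ := fun t => (q.path 1 g).getVert t with hv
  set I := Finset.Icc (10 * δ) (wordDist S 1 g - 10 * δ) with hI
  have hvd : ∀ t ∈ I, 10 * δ ≤ t ∧ wordDist S 1 (v t) = t ∧ wordDist S (v t) g + t = wordDist S 1 g ∧
      10 * δ ≤ wordDist S (v t) g := by
    intro t ht
    have := Finset.mem_Icc.1 ht
    have h1 := (q.geodesic 1 g).wordDist_getVert hS (t := t) (by omega)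
    refine ⟨this.1, h1.1, ?_, ?_⟩
    · rw [h1.2]; omega
    · rw [h1.2]; omega
  have hinj : Set.InjOn v I := fun t ht t' ht' h => by
    rw [← (hvd t ht).2.1, ← (hvd t' ht').2.1, h]
  set W := (I.image v).biUnion fun γ => (mineyevChain q δ γ 1).support with hW
  have hterm : ∀ γ ∈ I.image v, 1 ≤ ∑ x ∈ W, ‖b (γ, x)‖ ^ (p : ℝ) := by
    intro γ hγ
    obtain ⟨t, ht, rfl⟩ := Finset.mem_image.1 hγ
    obtain ⟨h1, h2, h3, h4⟩ := hvd t ht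
    have m1 := mineyevChain_mem_probabilityChains_sphere hfin hS q hδ hfine
      (a := v t) (b := 1) (by rw [wordDist_comm]; omega)
    have mg := mineyevChain_mem_probabilityChains_sphere hfin hS q hδ hfine h4
    rw [← sum_abs_div_chainLpNorm_rpow hp0 m1]
    have hsub : (mineyevChain q δ (v t) 1).support ⊆ W := fun x hx =>
      Finset.mem_biUnion.2 ⟨v t, hγ, hx⟩
    refine le_trans (Finset.sum_le_sum fun x hx => ?_)
      (Finset.sum_le_sum_of_subset_of_nonneg hsub fun _ _ _ => by positivity)
    have hx1 := m1.2.1 x (Finsupp.mem_support_iff.1 hx)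
    -- A common support point x would be closer than v t to 1 and to g, by at least 8δ each,
    -- contradicting the triangle inequality since v t lies on a geodesic.
    have hxg : mineyevChain q δ (v t) g x = 0 := by
      by_contra hne
      have hx2 := mg.2.1 x hne
      have h5 := wordDist_triangle hS 1 x g
      have h6 := hx1.2
      have h7 := hx2.2
      rw [wordDist_comm x 1, wordDist_comm (v t) 1] at h6
      omega
    rw [hb, eta_inv_mul hfin hS, normalizedChain, hxg, eta, normalizedChain]
    simp only [Rat.cast_zero, zero_div, zero_sub, norm_neg, Real.norm_eq_abs, le_refl]
  have hle := lp.sum_rpow_le_norm_rpow (p := (p : ℝ≥0∞)) (by simpa using hp0) b (I.image v ×ˢ W)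
  rw [ENNReal.toReal_natCast, Real.rpow_natCast, Finset.sum_product] at hle
  have h2 : ((I.image v).card : ℝ) ≤ ‖b‖ ^ p := by
    refine le_trans ?_ hle
    simpa using Finset.card_nsmul_le_sum _ _ 1 hterm
  rw [Finset.card_image_of_injOn hinj, hI, Nat.card_Icc] at h2
  have h3 : wordDist S 1 g ≤ (wordDist S 1 g - 10 * δ + 1 - 10 * δ) + 20 * δ := by omega
  have h4 : (wordDist S 1 g : ℝ) ≤
      ((wordDist S 1 g - 10 * δ + 1 - 10 * δ : ℕ) : ℝ) + 20 * δ := by exact_mod_cast h3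
  linarith

end Cocycle

/-! ### Affine isometric actions on l^p from formal coboundaries -/

section AffineAction

variable {X : Type*} {p : ℝ≥0∞}

theorem memlp_comp_equiv (hp : 0 < p.toReal) {f : X → ℝ} (hf : Memℓp f p) (e : X ≃ X) :
    Memℓp (fun z => f (e z)) p :=
  memℓp_gen ((e.summable_iff (f := fun z => ‖f z‖ ^ p.toReal)).2 (hf.summable hp))

/-- Reindexing by a permutation, as a linear isometry of `l^p`. -/
noncomputable def lpReindex (hp : 0 < p.toReal) [Fact (1 ≤ p)] (e : X ≃ X) :
    lp (fun _ : X => ℝ) p ≃ₗᵢ[ℝ] lp (fun _ : X => ℝ) p where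
  toFun ξ := ⟨fun z => ξ (e z), memlp_comp_equiv hp (lp.memℓp ξ) e⟩
  invFun ξ := ⟨fun z => ξ (e.symm z), memlp_comp_equiv hp (lp.memℓp ξ) e.symm⟩
  left_inv ξ := by ext z; exact congrArg ξ (e.apply_symm_apply z)
  right_inv ξ := by ext z; exact congrArg ξ (e.symm_apply_apply z)
  map_add' _ _ := rfl
  map_smul' _ _ := rfl
  norm_map' ξ := by
    rw [lp.norm_eq_tsum_rpow hp, lp.norm_eq_tsum_rpow hp]
    congr 1
    exact e.tsum_eq fun z => ‖ξ z‖ ^ p.toReal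

variable {G : Type*} [Group G] [MulAction G X]

/-- For b(g) = π(g)η - η one has b(xy) = π(x)b(y) + b(x) and b(x⁻¹) = -π(x⁻¹)b(x), and π preserves
l^p. -/
theorem memlp_smul_sub_of_closure (hp : 0 < p.toReal) {S : Set G} (hS : Subgroup.closure S = ⊤)
    {η : X → ℝ} (h : ∀ s ∈ S, Memℓp (fun z => η (s⁻¹ • z) - η z) p) (g : G) :
    Memℓp (fun z => η (g⁻¹ • z) - η z) p := by
  have hg : g ∈ Subgroup.closure S := by simp [hS]
  induction hg using Subgroup.closure_induction with
  | mem s hs => exact h s hs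
  | one =>
    have e : (fun z => η ((1 : G)⁻¹ • z) - η z) = fun _ => (0 : ℝ) := by funext z; simp
    rw [e]
    exact zero_mem_ℓp'
  | mul x y _ _ hx hy =>
    have e := (memlp_comp_equiv hp hy (MulAction.toPerm x⁻¹)).add hx
    refine (congrArg (Memℓp · p) ?_).mp e
    funext z
    simp [mul_smul]
  | inv x _ hx =>
    have e := (memlp_comp_equiv hp hx (MulAction.toPerm x)).neg
    refine (congrArg (Memℓp · p) ?_).mp e
    funext z
    simp

/-- The coboundary of `η`, as an element of `l^p`. -/
def lpCoboundary {η : X → ℝ} (h : ∀ g : G, Memℓp (fun z => η (g⁻¹ • z) - η z) p) (g : G) :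
    lp (fun _ : X => ℝ) p :=
  ⟨fun z => η (g⁻¹ • z) - η z, h g⟩

/-- The affine isometric action `α(g) ξ = π(g) ξ + (π(g) η - η)` on `l^p`. -/
noncomputable def lpAffineAction (hp : 0 < p.toReal) [Fact (1 ≤ p)] {η : X → ℝ}
    (h : ∀ g : G, Memℓp (fun z => η (g⁻¹ • z) - η z) p) :
    G →* (lp (fun _ : X => ℝ) p ≃ᵃⁱ[ℝ] lp (fun _ : X => ℝ) p) :=
  MonoidHom.mk' (fun g => (lpReindex hp (MulAction.toPerm g⁻¹)).toAffineIsometryEquiv.trans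
    (AffineIsometryEquiv.vaddConst ℝ (lpCoboundary h g))) fun g k => by
      ext ξ z
      change ξ ((g * k)⁻¹ • z) + (η ((g * k)⁻¹ • z) - η z) =
        (ξ (k⁻¹ • g⁻¹ • z) + (η (k⁻¹ • g⁻¹ • z) - η (g⁻¹ • z))) + (η (g⁻¹ • z) - η z)
      rw [mul_inv_rev, mul_smul]
      ring

theorem lpAffineAction_eq (hp : 0 < p.toReal) [Fact (1 ≤ p)] {η : X → ℝ}
    (h : ∀ g : G, Memℓp (fun z => η (g⁻¹ • z) - η z) p) (g : G) (ξ : lp (fun _ : X => ℝ) p) :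
    lpAffineAction hp h g ξ = lpReindex hp (MulAction.toPerm g⁻¹) ξ + lpCoboundary h g := rfl

theorem lpAffineAction_apply (hp : 0 < p.toReal) [Fact (1 ≤ p)] {η : X → ℝ}
    (h : ∀ g : G, Memℓp (fun z => η (g⁻¹ • z) - η z) p) (g : G) (ξ : lp (fun _ : X => ℝ) p)
    (z : X) : lpAffineAction hp h g ξ z = ξ (g⁻¹ • z) + (η (g⁻¹ • z) - η z) := rfl

/-- Growth of the cocycle alone thus gives properness at every vector ξ. -/
theorem norm_lpCoboundary_le (hp : 0 < p.toReal) [Fact (1 ≤ p)] {η : X → ℝ}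
    (h : ∀ g : G, Memℓp (fun z => η (g⁻¹ • z) - η z) p) (g : G) (ξ : lp (fun _ : X => ℝ) p) :
    ‖lpCoboundary h g‖ ≤ ‖lpAffineAction hp h g ξ‖ + ‖ξ‖ := by
  have h1 : lpCoboundary h g =
      lpAffineAction hp h g ξ - lpReindex hp (MulAction.toPerm g⁻¹) ξ := by
    rw [lpAffineAction_eq, add_sub_cancel_left]
  rw [h1]
  refine (norm_sub_le _ _).trans_eq ?_
  rw [LinearIsometryEquiv.norm_map]

end AffineAction

theorem exists_proper_lpAffineAction {Γ : Type u} [Group Γ] {S : Set Γ} (hfin : S.Finite)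
    (hS : Subgroup.closure S = ⊤) {δ : ℕ} (hδ : 1 ≤ δ) (hfine : TrianglesFine S (δ : ℝ))
    (q : EquivariantGeodesicBicombing S) :
    ∃ (p : ℝ≥0∞) (_ : Fact (1 ≤ p)), 2 < p ∧ p ≠ ∞ ∧
      ∃ α : Γ →* (LpSquare Γ p ≃ᵃⁱ[ℝ] LpSquare Γ p), IsProperAction α ∧
        ∀ (g : Γ) (ξ : LpSquare Γ p) (γ x : Γ), α g ξ (γ, x) = ξ (g⁻¹ * γ, g⁻¹ * x) +
          (eta q δ p.toReal (g⁻¹ * γ, g⁻¹ * x) - eta q δ p.toReal (γ, x)) := by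
  obtain ⟨p, hp3, hmem⟩ := exists_memlp_eta_sub hfin hS hδ hfine q
  have hp1 : (1 : ℝ≥0∞) ≤ p := by exact_mod_cast (by omega : 1 ≤ p)
  have : Fact ((1 : ℝ≥0∞) ≤ p) := ⟨hp1⟩
  have hp0 : 0 < (p : ℝ≥0∞).toReal := by
    rw [ENNReal.toReal_natCast]
    exact_mod_cast (by omega : 0 < p)
  have hcob := memlp_smul_sub_of_closure hp0 hS (η := eta q δ p) hmem
  refine ⟨p, ‹_›, by exact_mod_cast (by omega : 2 < p), ENNReal.natCast_ne_top p,
    lpAffineAction hp0 hcob, fun ξ => Filter.tendsto_atTop.2 fun R => ?_, fun g ξ γ x => ?_⟩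
  · rw [Filter.eventually_cofinite]
    refine (finite_ball hfin hS 1 ⌈(R + ‖ξ‖) ^ p + 20 * δ⌉₊).subset fun g hg => ?_
    have hg' : ‖lpAffineAction hp0 hcob g ξ‖ < R := not_le.1 hg
    have h1 := norm_lpCoboundary_le hp0 hcob g ξ
    have h2 := card_le_norm_rpow hfin hS hδ hfine q (by omega : 1 ≤ p) g (lpCoboundary hcob g)
      fun _ _ => rfl
    have h3 : ‖lpCoboundary hcob g‖ ^ p ≤ (R + ‖ξ‖) ^ p :=
      pow_le_pow_left₀ (norm_nonneg _) (by linarith) p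
    have h4 : (wordDist S 1 g : ℝ) ≤ ⌈(R + ‖ξ‖) ^ p + 20 * δ⌉₊ :=
      (h2.trans (by linarith)).trans (Nat.le_ceil _)
    exact_mod_cast h4
  · rw [ENNReal.toReal_natCast]
    exact lpAffineAction_apply hp0 hcob g ξ (γ, x)

/-! ### l^p as the L^p-space of counting measure -/

section CountingMeasure

open MeasureTheory

variable {X : Type*} {p : ℝ≥0∞}

theorem eLpNorm_count_eq [MeasurableSpace X] [MeasurableSingletonClass X] [Countable X]
    (hp0 : p ≠ 0) (hp : p ≠ ∞) (f : X → ℝ) :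
    eLpNorm f p Measure.count = (∑' z, ‖f z‖ₑ ^ p.toReal) ^ (1 / p.toReal) := by
  rw [eLpNorm_eq_lintegral_rpow_enorm_toReal hp0 hp, lintegral_count]

theorem enorm_rpow_eq_ofReal (f : X → ℝ) (z : X) :
    ‖f z‖ₑ ^ p.toReal = ENNReal.ofReal (‖f z‖ ^ p.toReal) := by
  rw [← ofReal_norm, ENNReal.ofReal_rpow_of_nonneg (norm_nonneg _) ENNReal.toReal_nonneg]

theorem memLp_count_iff [MeasurableSpace X] [DiscreteMeasurableSpace X] [Countable X]
    (hp0 : p ≠ 0) (hp : p ≠ ∞) (f : X → ℝ) : MemLp f p Measure.count ↔ Memℓp f p := by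
  have hpos := ENNReal.toReal_pos hp0 hp
  rw [MemLp, memℓp_gen_iff hpos, eLpNorm_count_eq hp0 hp,
    ENNReal.rpow_lt_top_iff_of_pos (by positivity)]
  simp_rw [enorm_rpow_eq_ofReal]
  constructor
  · rintro ⟨-, h⟩
    have := ENNReal.summable_toReal h.ne
    simpa only [ENNReal.toReal_ofReal (Real.rpow_nonneg (norm_nonneg _) _)] using this
  · intro h
    exact ⟨Measurable.aestronglyMeasurable (Measurable.of_discrete), h.tsum_ofReal_lt_top⟩

theorem norm_toLp_count [MeasurableSpace X] [DiscreteMeasurableSpace X] [Countable X]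
    (hp0 : p ≠ 0) (hp : p ≠ ∞) (ξ : lp (fun _ : X => ℝ) p)
    (h : MemLp (ξ : X → ℝ) p Measure.count) : ‖h.toLp‖ = ‖ξ‖ := by
  have hpos := ENNReal.toReal_pos hp0 hp
  rw [Lp.norm_toLp, eLpNorm_count_eq hp0 hp, lp.norm_eq_tsum_rpow hpos,
    ← ENNReal.toReal_rpow]
  simp_rw [enorm_rpow_eq_ofReal]
  rw [← ENNReal.ofReal_tsum_of_nonneg (fun _ => by positivity) ((lp.memℓp ξ).summable hpos),
    ENNReal.toReal_ofReal (tsum_nonneg fun _ => by positivity)]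

/-- `l^p(X)` is the `L^p`-space of the counting measure of a countable set `X`. -/
noncomputable def lpEquivLpCount [MeasurableSpace X] [DiscreteMeasurableSpace X] [Countable X]
    [Fact (1 ≤ p)] (hp : p ≠ ∞) :
    lp (fun _ : X => ℝ) p ≃ₗᵢ[ℝ] Lp ℝ p (Measure.count : Measure X) :=
  have hp0 : p ≠ 0 := (zero_lt_one.trans_le (Fact.out : 1 ≤ p)).ne'
  LinearIsometryEquiv.ofSurjective
    { toFun := fun ξ => ((memLp_count_iff hp0 hp ξ).2 (lp.memℓp ξ)).toLp
      map_add' := fun _ _ => rfl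
      map_smul' := fun _ _ => rfl
      norm_map' := fun ξ => norm_toLp_count hp0 hp ξ ((memLp_count_iff hp0 hp ξ).2 (lp.memℓp ξ)) }
    fun F => ⟨⟨(F : X → ℝ), (memLp_count_iff hp0 hp _).1 (Lp.memLp F)⟩, Lp.toLp_coeFn F (Lp.memLp F)⟩

end CountingMeasure

/-! ### Transport of actions and absence of fixed points -/

section Conjugation

variable {G E F : Type*} [Group G] [NormedAddCommGroup E] [NormedSpace ℝ E]
  [NormedAddCommGroup F] [NormedSpace ℝ F]

/-- The affine isometric action obtained from `α` by a linear isometry of Banach spaces. -/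
noncomputable def conjAffineAction (e : E ≃ₗᵢ[ℝ] F) (α : G →* (E ≃ᵃⁱ[ℝ] E)) : G →* (F ≃ᵃⁱ[ℝ] F) :=
  MonoidHom.mk' (fun g => (e.symm.toAffineIsometryEquiv.trans (α g)).trans e.toAffineIsometryEquiv)
    fun g h => by
      ext v
      change e (α (g * h) (e.symm v)) = e (α g (e.symm (e (α h (e.symm v)))))
      rw [map_mul, e.symm_apply_apply]
      rfl

theorem conjAffineAction_apply (e : E ≃ₗᵢ[ℝ] F) (α : G →* (E ≃ᵃⁱ[ℝ] E)) (g : G) (v : F) :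
    conjAffineAction e α g v = e (α g (e.symm v)) := rfl

theorem IsProperAction.exists_apply_ne [Infinite G] {α : G →* (E ≃ᵃⁱ[ℝ] E)}
    (hα : IsProperAction α) (ξ : E) : ∃ g, α g ξ ≠ ξ := by
  by_contra! h
  have h1 := hα ξ
  simp_rw [h] at h1
  exact Filter.not_tendsto_const_atTop _ _ h1

end Conjugation

theorem countable_of_closure {Γ : Type u} [Group Γ] {S : Set Γ} (hfin : S.Finite)
    (hS : Subgroup.closure S = ⊤) : Countable Γ := by
  rw [← Set.countable_univ_iff]
  have e : (Set.univ : Set Γ) = ⋃ n : ℕ, {x | wordDist S 1 x ≤ n} :=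
    (Set.eq_univ_of_forall fun x => Set.mem_iUnion.2 ⟨wordDist S 1 x, Nat.le_refl (wordDist S 1 x)⟩).symm
  rw [e]
  exact Set.countable_iUnion fun n => (finite_ball hfin hS 1 n).countable

end YuHyperbolic

theorem theorem1p1 {Γ : Type u} [Group Γ] (hΓ : YuHyperbolic.IsHyperbolicGroup Γ) :
    -- a proper affine isometric action on some `l^p(Γ × Γ)`
    (∃ (p : ℝ≥0∞) (_ : Fact (1 ≤ p)), 2 ≤ p ∧ p ≠ ∞ ∧
      ∃ α : Γ →* (YuHyperbolic.LpSquare Γ p ≃ᵃⁱ[ℝ] YuHyperbolic.LpSquare Γ p),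
        YuHyperbolic.IsProperAction α) ∧
    -- for all choices in Mineyev's construction, `α(g) ξ = π(g) ξ + π(g) η - η` is such an action
    (∀ S : Set Γ, S.Finite → Subgroup.closure S = ⊤ →
      ∀ δ : ℕ, 1 ≤ δ → YuHyperbolic.TrianglesFine S (δ : ℝ) →
      ∀ q : YuHyperbolic.EquivariantGeodesicBicombing S,
      ∃ (p : ℝ≥0∞) (_ : Fact (1 ≤ p)), 2 ≤ p ∧ p ≠ ∞ ∧
        ∃ α : Γ →* (YuHyperbolic.LpSquare Γ p ≃ᵃⁱ[ℝ] YuHyperbolic.LpSquare Γ p),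
          YuHyperbolic.IsProperAction α ∧
          ∀ (g : Γ) (ξ : YuHyperbolic.LpSquare Γ p) (γ x : Γ),
            α g ξ (γ, x) = ξ (g⁻¹ * γ, g⁻¹ * x) +
              (YuHyperbolic.eta q δ p.toReal (g⁻¹ * γ, g⁻¹ * x) -
                YuHyperbolic.eta q δ p.toReal (γ, x))) ∧
    -- an infinite hyperbolic group with (T) acts without fixed point on an `L^p`-space
    (Infinite Γ → YuHyperbolic.HasPropertyT Γ →
      ∃ (p : ℝ≥0∞) (_ : Fact (1 ≤ p)), 2 < p ∧ p ≠ ∞ ∧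
        ∃ (X : Type u) (_ : MeasurableSpace X) (μ : MeasureTheory.Measure X),
          MeasureTheory.SigmaFinite μ ∧
          ∃ α : Γ →* (MeasureTheory.Lp ℝ p μ ≃ᵃⁱ[ℝ] MeasureTheory.Lp ℝ p μ),
            ∀ ξ : MeasureTheory.Lp ℝ p μ, ∃ g : Γ, α g ξ ≠ ξ) := by
  obtain ⟨S, hfin, hS, δ₀, -, hfine₀⟩ := hΓ
  obtain ⟨q⟩ := YuHyperbolic.exists_equivariantGeodesicBicombing hS
  -- Fineness is monotone in δ; the added 1 makes the integer constant at least 1 even when δ₀ = 0.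
  have hfine : YuHyperbolic.TrianglesFine S ((⌈δ₀⌉₊ + 1 : ℕ) : ℝ) := by
    intro a b c α β hα hβ t ht
    refine (hfine₀ a b c α β hα hβ t ht).trans ((Nat.le_ceil δ₀).trans ?_)
    exact_mod_cast Nat.le_succ _
  obtain ⟨p, hp1, hp2, hp, α, hα, -⟩ :=
    YuHyperbolic.exists_proper_lpAffineAction hfin hS (Nat.le_add_left 1 _) hfine q
  refine ⟨⟨p, hp1, hp2.le, hp, α, hα⟩, ?_, fun _ _ => ?_⟩
  · intro S' hfin' hS' δ' hδ' hfine' q'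
    obtain ⟨p', hp1', hp2', h⟩ :=
      YuHyperbolic.exists_proper_lpAffineAction hfin' hS' hδ' hfine' q'
    exact ⟨p', hp1', hp2'.le, h⟩
  · have := YuHyperbolic.countable_of_closure hfin hS
    let : MeasurableSpace (Γ × Γ) := ⊤
    have : DiscreteMeasurableSpace (Γ × Γ) := ⟨fun _ => trivial⟩
    refine ⟨p, hp1, hp2, hp, Γ × Γ, ⊤, MeasureTheory.Measure.count, inferInstance,
      YuHyperbolic.conjAffineAction (YuHyperbolic.lpEquivLpCount hp) α, fun ξ => ?_⟩
    obtain ⟨g, hg⟩ := hα.exists_apply_ne ((YuHyperbolic.lpEquivLpCount hp).symm ξ)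
    refine ⟨g, fun h => hg ?_⟩
    rw [YuHyperbolic.conjAffineAction_apply] at h
    rw [LinearIsometryEquiv.eq_symm_apply]
    exact h
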